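/- Let $d\ge 2$ and let $\Lambda$ be a stationary random Borel measure on $\mathbb R^d$ (measurable with respect to the evaluation $\sigma$-algebra) with $\mathbb E[\Lambda([0,1]^d)]=1$. For $\lambda>0$ let $X^\lambda$ be a Cox process with intensity measure $\lambda\Lambda$, i.e. conditioned on $\Lambda$ it is a Poisson point process with intensity measure $\lambda\Lambda$. For $r>0$ let $g_r(X^\lambda)$ be the Gilbert graph, in which two points of $X^\lambda$ are joined by an edge if their Euclidean distance is less than $r$; it percolates if it has an infinite connected component. Put $\lambda_c(r)=\inf\{\lambda>0:\ \mathbb P(g_r(X^\lambda)\text{ percolates})>0\}\in[0,\infty]$, with $\inf\emptyset=\infty$. Write $Q_s(x)=x+[-s/2,s/2]^d$, $Q_s=Q_s(o)$, and let $\Lambda_B$ be the restriction of $\Lambda$ to $B$. The random measure $\Lambda$ is stabilizing, with stabilization radii $R=\{R_x\}_{x\in\mathbb R^d}$, if $R$ is a random field with values in $[0,\infty]$ on the probability space of $\Lambda$ such that 1. $(\Lambda,R)$ is jointly stationary; 2. $\lim_{n\to\infty}\mathbb P\big(\sup_{y\in Q_n\cap\mathbb Q^d}R_y<n\big)=1$;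 3. for all integers $n\ge1$, all bounded measurable functions $f\ge 0$ on the space of Borel measures and all finite $\varphi\subset\mathbb R^d$ whose points have pairwise distances greater than $3n$, the random variables $f(\Lambda_{Q_n(x)})\,\mathbf 1\{\sup_{y\in Q_n(x)\cap\mathbb Q^d}R_y<n\}$, $x\in\varphi$, are independent. It is asymptotically essentially connected if it is stabilizing with some field $R$ of stabilization radii such that, almost surely, for all integers $n\ge1$ with $\sup_{y\in Q_{2n}\cap\mathbb Q^d}R_y<n/2$, the support of $\Lambda_{Q_n}$ is non-empty and is contained in a connected component of the support of $\Lambda_{Q_{2n}}$. Then, if $\Lambda$ is asymptotically essentially connected, $\lambda_c(r)<\infty$ for every $r>0$. -/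

import Mathlib

open MeasureTheory ProbabilityTheory Filter Topology
open scoped ENNReal NNReal

noncomputable section

namespace CoxPercolation

/-- `ℝ^d` with the Euclidean norm. -/
abbrev Space (d : ℕ) : Type := EuclideanSpace ℝ (Fin d)

/-- The closed cube `Q_s(x) = x + [-s/2, s/2]^d`. -/
def cube {d : ℕ} (s : ℝ) (x : Space d) : Set (Space d) :=
  {y | ∀ i, |y i - x i| ≤ s / 2}

/-- The set `ℚ^d` of points with rational coordinates. -/
def rationalPoints (d : ℕ) : Set (Space d) :=
  {y | ∀ i, ∃ q : ℚ, y i = (q : ℝ)}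

/-- The measure `μ` seen from `x`, that is, `B ↦ μ (B + x)`. -/
def shift {d : ℕ} (x : Space d) (μ : Measure (Space d)) : Measure (Space d) :=
  μ.map (fun y => y - x)

/-- A stationary random measure `Λ` on `ℝ^d`, measurable for the evaluation `σ`-algebra on the
space of Borel measures, with `E[Λ([0,1]^d)] = 1`. -/
structure IsStationaryRandomMeasure {d : ℕ} {Ω : Type*} [MeasurableSpace Ω]
    (P : Measure Ω) (Λ : Ω → Measure (Space d)) : Prop where
  measurable : Measurable Λ
  stationary : ∀ x : Space d, IdentDistrib (fun ω => shift x (Λ ω)) Λ P P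
  intensity : ∫⁻ ω, Λ ω {y | ∀ i, 0 ≤ y i ∧ y i ≤ 1} ∂P = 1

/-- `sup {R_y : y ∈ Q_s(x) ∩ ℚ^d}` as an element of `[0, ∞]`. -/
def supRadius {d : ℕ} {Ω : Type*} (R : Space d → Ω → ℝ≥0∞) (s : ℝ) (x : Space d) (ω : Ω) :
    ℝ≥0∞ :=
  ⨆ y ∈ cube s x ∩ rationalPoints d, R y ω

/-- `R` is a field of stabilization radii for the random measure `Λ`. -/
structure IsStabilizationField {d : ℕ} {Ω : Type*} [MeasurableSpace Ω]
    (P : Measure Ω) (Λ : Ω → Measure (Space d)) (R : Space d → Ω → ℝ≥0∞) : Prop where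
  measurable : ∀ y, Measurable (R y)
  /-- Joint stationarity; the space of fields carries the product `σ`-algebra. -/
  jointly_stationary : ∀ x : Space d,
    IdentDistrib (fun ω => (shift x (Λ ω), fun y : Space d => R (y + x) ω))
      (fun ω => (Λ ω, fun y : Space d => R y ω)) P P
  tendsto_one :
    Tendsto (fun n : ℕ => P {ω | supRadius R n 0 ω < (n : ℝ≥0∞)}) atTop (𝓝 1)
  indep : ∀ n : ℕ, 1 ≤ n → ∀ f : Measure (Space d) → ℝ≥0, Measurable f →
    (∃ C : ℝ≥0, ∀ μ, f μ ≤ C) →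
    ∀ φ : Finset (Space d), (∀ x ∈ φ, ∀ y ∈ φ, y ≠ x → 3 * (n : ℝ) < dist x y) →
    iIndepFun (fun (x : φ) => Set.indicator {ω | supRadius R n (x : Space d) ω < (n : ℝ≥0∞)}
      (fun ω => f ((Λ ω).restrict (cube n (x : Space d))))) P

/-- `Λ` is asymptotically essentially connected: it is stabilizing with some field `R` of radii
such that, almost surely, for all `n ≥ 1`, whenever the radii in `Q_{2n}` are bounded by a number
below `n / 2`, the support of `Λ` restricted to `Q_n` is non-empty and contained in a connected
component of the support of `Λ` restricted to `Q_{2n}`. -/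
def IsAsymptoticallyEssentiallyConnected {d : ℕ} {Ω : Type*} [MeasurableSpace Ω]
    (P : Measure Ω) (Λ : Ω → Measure (Space d)) : Prop :=
  ∃ R : Space d → Ω → ℝ≥0∞, IsStabilizationField P Λ R ∧
    ∀ᵐ ω ∂P, ∀ n : ℕ, 1 ≤ n → supRadius R (2 * n) 0 ω < (n : ℝ≥0∞) / 2 →
      ((Λ ω).restrict (cube n 0)).support.Nonempty ∧
      ∃ x ∈ ((Λ ω).restrict (cube (2 * n) 0)).support,
        ((Λ ω).restrict (cube n 0)).support ⊆
          connectedComponentIn ((Λ ω).restrict (cube (2 * n) 0)).support x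

/-- A locally finite counting measure, i.e. a locally finite configuration of points (possibly
with multiplicities). -/
def IsCountingMeasure {d : ℕ} (ξ : Measure (Space d)) : Prop :=
  ∀ B : Set (Space d), MeasurableSet B → Bornology.IsBounded B → ∃ k : ℕ, ξ B = k

/-- `X` is a Cox process with random intensity measure `l Λ`: a point process which, conditioned
on `Λ`, is a Poisson point process with intensity measure `l Λ`. That is, conditioned on `Λ`, the
numbers of points in disjoint bounded Borel sets `B i` are independent and Poisson distributed with
parameters `l Λ(B i)`; the conditioning is expressed by integrating over the events `{Λ ∈ A}`. -/
structure IsCoxProcess {d : ℕ} {Ω : Type*} [MeasurableSpace Ω]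
    (P : Measure Ω) (Λ : Ω → Measure (Space d)) (l : ℝ≥0) (X : Ω → Measure (Space d)) :
    Prop where
  measurable : Measurable X
  counting : ∀ᵐ ω ∂P, IsCountingMeasure (X ω)
  poisson : ∀ (k : ℕ) (B : Fin k → Set (Space d)),
    (∀ i, MeasurableSet (B i)) → (∀ i, Bornology.IsBounded (B i)) →
    Pairwise (Function.onFun Disjoint B) →
    ∀ (m : Fin k → ℕ) (A : Set (Measure (Space d))), MeasurableSet A →
      P (Λ ⁻¹' A ∩ {ω | ∀ i, X ω (B i) = (m i : ℝ≥0∞)}) =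
        ∫⁻ ω in Λ ⁻¹' A, ∏ i, poissonMeasure (l * (Λ ω (B i)).toNNReal) {m i} ∂P

/-- The points of a configuration. -/
def points {d : ℕ} (ξ : Measure (Space d)) : Set (Space d) :=
  {x | ξ {x} ≠ 0}

/-- The Gilbert graph `g_r(ξ)`: two distinct points of the configuration are adjacent if their
distance is less than `r`. -/
def gilbertGraph {d : ℕ} (r : ℝ) (ξ : Measure (Space d)) : SimpleGraph (points ξ) where
  Adj x y := x ≠ y ∧ dist (x : Space d) (y : Space d) < r
  symm := ⟨fun _ _ h => ⟨h.1.symm, by rw [dist_comm]; exact h.2⟩⟩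
  loopless := ⟨fun _ h => h.1 rfl⟩

/-- `g_r(ξ)` contains an infinite connected component. -/
def Percolates {d : ℕ} (r : ℝ) (ξ : Measure (Space d)) : Prop :=
  ∃ C : (gilbertGraph r ξ).ConnectedComponent, C.supp.Infinite

/-- The critical intensity `λ_c(r) = inf {λ > 0 : P(g_r(X^λ) percolates) > 0}`, an element of
`[0, ∞]`, which is `∞` if there is no such `λ`. -/
def criticalIntensity {d : ℕ} {Ω : Type*} [MeasurableSpace Ω]
    (P : Measure Ω) (X : ℝ≥0 → Ω → Measure (Space d)) (r : ℝ) : ℝ≥0∞ :=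
  ⨅ (l : ℝ≥0) (_ : 0 < l ∧ 0 < P {ω | Percolates r (X l ω)}), (l : ℝ≥0∞)

end CoxPercolation

end

/-! The proof compares the Gilbert graph with site percolation on a coarse copy of `ℤ²` and closes
with a Peierls argument.

Space is tiled by cells of side `1/q`, so small that points in cells whose indices differ by at most
3 are within distance `r`. Sites of `ℤ²` are placed at spacing `3k` in a coordinate plane. With `b =
q * k`, a site is good if some charged cell has index at most `b` around it, all charged cells of
index at most `4b` are chained through charged cells of the window of index at most `11b`, and every
charged cell of the window contains a Cox point. Neighbouring good sites are then linked in the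
Gilbert graph, and the inner blocks of different sites share no cell, so an infinite good cluster
gives an infinite component (`percolates_of_infinite_originCluster`).

Essential connectedness at the scales `k` and `10 * k` makes the geometric part of goodness likely
(`goodPattern_of_support`). For fixed `q` and `k`, letting the intensity grow fills all charged
cells (`tendsto_lintegral_goodProb`). Distant sites are handled in two stages: given `Λ`, disjoint
windows are independent by the Poisson property (`IsCoxProcess.measure_forall_not_goodSite_le`), and
the conditional probabilities are decoupled by stabilization, at the price of the probability of a
large radius (`IsStabilizationField.lintegral_prod_le`).

A finite cluster of the origin forces a long self-avoiding bad path of diagonal adjacency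
(`exists_path_of_finite_originCluster`). A union bound excludes this with positive probability
(`not_ae_finite_originCluster`). The planar topology is replaced by a mod 2 cohomology argument: the
edges between the cluster and one outer boundary component form a closed cochain, whose primitive
counts crossings along a horizontal ray. -/

noncomputable section

namespace CoxPercolation

/-! ### Percolation of a random subset of the square lattice -/

/-- Adjacency in `ℤ²` with diagonals, equality allowed. -/
def StarAdj (u v : ℤ × ℤ) : Prop := |u.1 - v.1| ≤ 1 ∧ |u.2 - v.2| ≤ 1

/-- Nearest neighbour adjacency in `ℤ²`. -/
def LatticeAdj (u v : ℤ × ℤ) : Prop := |u.1 - v.1| + |u.2 - v.2| = 1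

/-- The cluster of the origin in the subset `G` of `ℤ²`; it is empty if `0 ∉ G`. -/
def originCluster (G : Set (ℤ × ℤ)) : Set (ℤ × ℤ) :=
  {z | 0 ∈ G ∧ Relation.ReflTransGen (fun u v => v ∈ G ∧ LatticeAdj u v) 0 z}

/-- The graph of diagonal adjacency on the complement of `G`. -/
def starGraph (G : Set (ℤ × ℤ)) : SimpleGraph (ℤ × ℤ) where
  Adj u v := u ≠ v ∧ StarAdj u v ∧ u ∉ G ∧ v ∉ G
  symm := ⟨fun u v h => ⟨h.1.symm, ⟨by rw [abs_sub_comm]; exact h.2.1.1,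
    by rw [abs_sub_comm]; exact h.2.1.2⟩, h.2.2.2, h.2.2.1⟩⟩
  loopless := ⟨fun _ h => h.1 rfl⟩

theorem LatticeAdj.starAdj {u v : ℤ × ℤ} (h : LatticeAdj u v) : StarAdj u v := by
  unfold LatticeAdj at h
  have h1 := abs_nonneg (u.1 - v.1)
  have h2 := abs_nonneg (u.2 - v.2)
  exact ⟨by omega, by omega⟩

theorem originCluster_subset (G : Set (ℤ × ℤ)) : originCluster G ⊆ G := by
  rintro z ⟨h0, hz⟩
  induction hz with
  | refl => exact h0
  | tail _ h _ => exact h.1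

theorem notMem_of_latticeAdj_originCluster {G : Set (ℤ × ℤ)} {u v : ℤ × ℤ}
    (hu : u ∈ originCluster G) (hv : v ∉ originCluster G) (h : LatticeAdj u v) : v ∉ G :=
  fun hvG => hv ⟨hu.1, hu.2.tail ⟨hvG, h⟩⟩

open Classical in
/-- The mod 2 indicator of the edges between `C` and `K`. -/
def cutIndicator (C K : Set (ℤ × ℤ)) (u v : ℤ × ℤ) : ZMod 2 :=
  if (u ∈ C ∧ v ∈ K) ∨ (v ∈ C ∧ u ∈ K) then 1 else 0

theorem cutIndicator_comm (C K : Set (ℤ × ℤ)) (u v : ℤ × ℤ) :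
    cutIndicator C K u v = cutIndicator C K v u := by
  unfold cutIndicator
  congr 1
  exact propext or_comm

/-- The cut is a closed mod 2 cochain. If the plaquette meets `K`, all its edges leaving `C` end in
`K`, so the indicator is there the coboundary of the indicator of `C`; if it misses `K`, every term
vanishes. -/
theorem cutIndicator_plaquette {C K : Set (ℤ × ℤ)} {p q r s : ℤ × ℤ}
    (hCK : ∀ u ∈ C, u ∉ K)
    (h : ∀ t ∈ ({p, q, r, s} : Set (ℤ × ℤ)), ∀ u ∈ ({p, q, r, s} : Set (ℤ × ℤ)),
      ∀ v ∈ ({p, q, r, s} : Set (ℤ × ℤ)), LatticeAdj u v → t ∈ K → u ∈ C → v ∉ C → v ∈ K)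
    (hpq : LatticeAdj p q) (hqr : LatticeAdj q r) (hrs : LatticeAdj r s) (hsp : LatticeAdj s p) :
    cutIndicator C K p q + cutIndicator C K q r + cutIndicator C K r s +
      cutIndicator C K s p = 0 := by
  have symm : ∀ {u v}, LatticeAdj u v → LatticeAdj v u := fun {u v} h => by
    unfold LatticeAdj at *; rw [abs_sub_comm, abs_sub_comm v.2]; exact h
  by_cases hK : ∃ t ∈ ({p, q, r, s} : Set (ℤ × ℤ)), t ∈ K
  · obtain ⟨t, ht, htK⟩ := hK
    have key : ∀ u ∈ ({p, q, r, s} : Set (ℤ × ℤ)), ∀ v ∈ ({p, q, r, s} : Set (ℤ × ℤ)),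
        LatticeAdj u v → cutIndicator C K u v =
          cutIndicator C Cᶜ u v := by
      intro u hu v hv huv
      have h1 := h t ht u hu v hv huv htK
      have h2 := h t ht v hv u hu (symm huv) htK
      have h3 := hCK u
      have h4 := hCK v
      unfold cutIndicator
      congr 1
      simp only [Set.mem_compl_iff, eq_iff_iff]
      tauto
    rw [key p (by simp) q (by simp) hpq, key q (by simp) r (by simp) hqr,
      key r (by simp) s (by simp) hrs, key s (by simp) p (by simp) hsp]
    unfold cutIndicator
    by_cases a : p ∈ C <;> by_cases b : q ∈ C <;> by_cases c : r ∈ C <;> by_cases e : s ∈ C <;>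
      simp [a, b, c, e] <;> decide
  · push Not at hK
    have key : ∀ u ∈ ({p, q, r, s} : Set (ℤ × ℤ)), ∀ v ∈ ({p, q, r, s} : Set (ℤ × ℤ)),
        cutIndicator C K u v = 0 := by
      intro u hu v hv
      have h1 := hK u hu
      have h2 := hK v hv
      simp [cutIndicator, h1, h2]
    rw [key p (by simp) q (by simp), key q (by simp) r (by simp),
      key r (by simp) s (by simp), key s (by simp) p (by simp)]
    simp

/-- The parity of the number of cut edges on a horizontal segment of length `L`. -/
def rayParity (C K : Set (ℤ × ℤ)) (L : ℕ) (x y : ℤ) : ZMod 2 :=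
  ∑ j ∈ Finset.range L, cutIndicator C K (x + j, y) (x + j + 1, y)

/-- With `rayParity_vertical`, this makes `rayParity` a primitive of the cut cochain wherever the
far end of the ray is clear of the cut. -/
theorem rayParity_horizontal (C K : Set (ℤ × ℤ)) (L : ℕ) (x y : ℤ)
    (h : cutIndicator C K (x + L, y) (x + L + 1, y) = 0) :
    rayParity C K L x y = cutIndicator C K (x, y) (x + 1, y) + rayParity C K L (x + 1) y := by
  have h1 := Finset.sum_range_succ (fun j : ℕ => cutIndicator C K (x + j, y) (x + j + 1, y)) L
  have h2 := Finset.sum_range_succ' (fun j : ℕ => cutIndicator C K (x + j, y) (x + j + 1, y)) L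
  rw [h, add_zero] at h1
  unfold rayParity
  rw [← h1, h2, add_comm]
  congr 1
  · simp
  · refine Finset.sum_congr rfl fun j _ => ?_
    push_cast
    rw [add_right_comm x 1 (j : ℤ), ← add_assoc x]

/-- Adding up the plaquettes between two adjacent rays cancels all vertical edges except the two at
the ends. -/
theorem rayParity_vertical (C K : Set (ℤ × ℤ)) (L : ℕ) (x y : ℤ)
    (hplaq : ∀ x y : ℤ, cutIndicator C K (x, y) (x + 1, y) +
      cutIndicator C K (x + 1, y) (x + 1, y + 1) + cutIndicator C K (x + 1, y + 1) (x, y + 1) +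
      cutIndicator C K (x, y + 1) (x, y) = 0)
    (h : cutIndicator C K (x + L, y) (x + L, y + 1) = 0) :
    rayParity C K L x y = cutIndicator C K (x, y) (x, y + 1) + rayParity C K L x (y + 1) := by
  have key : ∀ n : ℕ, rayParity C K n x y + rayParity C K n x (y + 1) =
      cutIndicator C K (x, y) (x, y + 1) + cutIndicator C K (x + n, y) (x + n, y + 1) := by
    intro n
    induction n with
    | zero => simp [rayParity, CharTwo.add_self_eq_zero]
    | succ n ih =>
      have hp := hplaq (x + n) y
      rw [cutIndicator_comm C K (x + n, y + 1), cutIndicator_comm C K (x + n + 1, y + 1)] at hp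
      simp only [rayParity, Finset.sum_range_succ] at ih ⊢
      push_cast
      rw [← add_assoc x]
      have two : ∀ a : ZMod 2, a + a = 0 := CharTwo.add_self_eq_zero
      linear_combination ih + hp - two (cutIndicator C K (x + n + 1, y) (x + n + 1, y + 1))
  have h1 := key L
  rw [h, add_zero] at h1
  rw [← h1, add_assoc, CharTwo.add_self_eq_zero, add_zero]

/-- If the cluster of the origin is finite, its outer boundary joins the two half-axes. -/
theorem exists_reachable_of_finite_originCluster {G : Set (ℤ × ℤ)} (h0 : 0 ∈ G)
    (hfin : (originCluster G).Finite) :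
    ∃ s t : ℤ, 0 ≤ s ∧ t ≤ 0 ∧ (s + 1, (0 : ℤ)) ∉ G ∧
      (starGraph G).Reachable (s + 1, 0) (t - 1, 0) := by
  set C := originCluster G with hC
  have h0C : ((0 : ℤ), (0 : ℤ)) ∈ C := ⟨h0, Relation.ReflTransGen.refl⟩
  obtain ⟨M, hM⟩ : ∃ M : ℕ, ∀ z ∈ C, |z.1| < M ∧ |z.2| < M := by
    obtain ⟨m, hm⟩ := (hfin.image fun z => (|z.1| + |z.2|).toNat).bddAbove
    refine ⟨m + 1, fun z hz => ?_⟩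
    have := hm ⟨z, hz, rfl⟩
    have h1 := abs_nonneg z.1
    have h2 := abs_nonneg z.2
    simp only at this
    constructor <;> omega
  obtain ⟨s, hs, hsmax⟩ := Int.exists_greatest_of_bdd (P := fun x => (x, (0 : ℤ)) ∈ C)
    ⟨M, fun z hz => (le_abs_self z).trans (hM _ hz).1.le⟩ ⟨0, h0C⟩
  obtain ⟨t, ht, htmin⟩ := Int.exists_least_of_bdd (P := fun x => (x, (0 : ℤ)) ∈ C)
    ⟨-M, fun z hz => (neg_le_of_abs_le (hM _ hz).1.le)⟩ ⟨0, h0C⟩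
  have hs1 : (s + 1, (0 : ℤ)) ∉ G :=
    notMem_of_latticeAdj_originCluster hs (fun h => by have := hsmax _ h; omega)
      (by simp [LatticeAdj])
  refine ⟨s, t, hsmax 0 h0C, htmin 0 h0C, hs1, ?_⟩
  -- The goal is `(t - 1, 0) ∈ K`. The primitive `h` of the cut between `C` and `K` is constant on
  -- `C` and equals 1 at `(s, 0)`, whose ray has a single cut edge; coming from the far left, it
  -- could only be 0 at `(t, 0)` if `(t - 1, 0)` were outside `K`.
  set K : Set (ℤ × ℤ) := {z | z ∉ G ∧ (starGraph G).Reachable (s + 1, 0) z} with hK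
  have hCG : C ⊆ G := originCluster_subset G
  have hCK : ∀ u ∈ C, u ∉ K := fun u hu hk => hk.1 (hCG hu)
  have hext : ∀ u ∈ K, ∀ v, StarAdj u v → v ∉ G → v ∈ K := by
    rintro u ⟨huG, hu⟩ v huv hv
    refine ⟨hv, ?_⟩
    by_cases e : u = v
    · rwa [← e]
    · exact hu.trans (SimpleGraph.Adj.reachable ⟨e, huv, huG, hv⟩)
  have hplaq : ∀ x y : ℤ, cutIndicator C K (x, y) (x + 1, y) +
      cutIndicator C K (x + 1, y) (x + 1, y + 1) + cutIndicator C K (x + 1, y + 1) (x, y + 1) +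
      cutIndicator C K (x, y + 1) (x, y) = 0 := by
    intro x y
    refine cutIndicator_plaquette hCK ?_ (by simp [LatticeAdj]) (by simp [LatticeAdj])
      (by simp [LatticeAdj]) (by simp [LatticeAdj])
    intro a ha u hu v hv huv haK huC hvC
    refine hext a haK v ?_ (notMem_of_latticeAdj_originCluster huC hvC huv)
    simp only [Set.mem_insert_iff, Set.mem_singleton_iff] at ha hv
    rcases ha with rfl | rfl | rfl | rfl <;> rcases hv with rfl | rfl | rfl | rfl <;>
      simp [StarAdj]
  have hzero : ∀ u v : ℤ × ℤ, u ∉ C → v ∉ C → cutIndicator C K u v = 0 := by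
    intro u v hu hv
    simp [cutIndicator, hu, hv]
  have hright : ∀ x y : ℤ, (M : ℤ) ≤ x → (x, y) ∉ C := by
    intro x y hx h
    have := (hM _ h).1
    have := le_abs_self x
    simp only at *
    omega
  -- A ray of this length starting at abscissa at least `-M` ends at abscissa at least `M`, beyond
  -- `C`.
  set L := 2 * M with hL
  set h := rayParity C K L with hh
  have hor : ∀ x y : ℤ, -(M : ℤ) ≤ x →
      h x y = cutIndicator C K (x, y) (x + 1, y) + h (x + 1) y := fun x y hx =>
    rayParity_horizontal C K L x y (hzero _ _ (hright _ _ (by push_cast [hL]; omega))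
      (hright _ _ (by push_cast [hL]; omega)))
  have ver : ∀ x y : ℤ, -(M : ℤ) ≤ x →
      h x y = cutIndicator C K (x, y) (x, y + 1) + h x (y + 1) := fun x y hx =>
    rayParity_vertical C K L x y hplaq (hzero _ _ (hright _ _ (by push_cast [hL]; omega))
      (hright _ _ (by push_cast [hL]; omega)))
  have hCC : ∀ u ∈ C, ∀ v ∈ C, cutIndicator C K u v = 0 := by
    intro u hu v hv
    simp [cutIndicator, hCK u hu, hCK v hv]
  have hlow : ∀ z ∈ C, -(M : ℤ) ≤ z.1 := fun z hz => neg_le_of_abs_le (hM z hz).1.le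
  have hconst : ∀ z ∈ C, h z.1 z.2 = h 0 0 := by
    rintro z ⟨_, hz⟩
    induction hz with
    | refl => rfl
    | @tail u v huv hv ih =>
      have hu : u ∈ C := ⟨h0, huv⟩
      have hvC : v ∈ C := ⟨h0, huv.tail hv⟩
      rw [← ih]
      obtain ⟨u1, u2⟩ := u
      obtain ⟨v1, v2⟩ := v
      have hadj := hv.2
      unfold LatticeAdj at hadj
      simp only at hadj ⊢
      have hc : (v1 = u1 + 1 ∧ v2 = u2) ∨ (u1 = v1 + 1 ∧ v2 = u2) ∨ (v1 = u1 ∧ v2 = u2 + 1) ∨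
          (v1 = u1 ∧ u2 = v2 + 1) := by
        rcases abs_cases (u1 - v1) with h1 | h1 <;> rcases abs_cases (u2 - v2) with h2 | h2 <;>
          omega
      rcases hc with ⟨rfl, rfl⟩ | ⟨rfl, rfl⟩ | ⟨rfl, rfl⟩ | ⟨rfl, rfl⟩
      · rw [hor u1 _ (hlow _ hu), hCC _ hu _ hvC, zero_add]
      · rw [hor v1 _ (hlow _ hvC), hCC _ hvC _ hu, zero_add]
      · rw [ver _ u2 (hlow _ hu), hCC _ hu _ hvC, zero_add]
      · rw [ver _ v2 (hlow _ hvC), hCC _ hvC _ hu, zero_add]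
  have hMpos : 0 < M := by
    have := (hM _ h0C).1
    simpa using this
  have hs_one : h s 0 = 1 := by
    rw [hh, rayParity, Finset.sum_eq_single 0]
    · have : ((s + 1, (0 : ℤ)) : ℤ × ℤ) ∈ K := ⟨hs1, SimpleGraph.Reachable.refl _⟩
      simp [cutIndicator, hs, this]
    · intro j _ hj
      refine hzero _ _ (fun hc => ?_) (fun hc => ?_) <;>
      · have := hsmax _ hc
        omega
    · intro hn
      exact absurd (Finset.mem_range.2 (by omega)) hn
  have ht_one : h t 0 = 1 := by
    rw [hconst (t, 0) ht, ← hconst (s, 0) hs, hs_one]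
  have hleft : ∀ y, (-(M : ℤ), y) ∉ C := fun y hc => by
    have := (hM _ hc).1
    simp at this
  -- The ray at height `M` misses `C`, and so does the column at abscissa `-M`, so the value 0
  -- descends this column.
  have hcol : ∀ n : ℕ, h (-M) (M - n) = 0 := by
    intro n
    induction n with
    | zero =>
      rw [hh, rayParity]
      have htop : ∀ x : ℤ, (x, (M : ℤ)) ∉ C := fun x hc => by
        have := (hM _ hc).2
        simp at this
      exact Finset.sum_eq_zero fun j _ => hzero _ _ (by simpa using htop _) (by simpa using htop _)
    | succ n ih =>
      rw [ver _ _ le_rfl, hzero _ _ (hleft _) (hleft _), zero_add]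
      convert ih using 2
      push_cast
      ring
  have hM0 : h (-M) 0 = 0 := by simpa using hcol M
  by_contra hcon
  have ht1 : (t - 1, (0 : ℤ)) ∉ K := fun hk => hcon hk.2
  have hrow : ∀ n : ℕ, -(M : ℤ) + n ≤ t → h (-M + n) 0 = 0 := by
    intro n
    induction n with
    | zero => intro _; simpa using hM0
    | succ n ih =>
      intro hn
      push_cast at hn ⊢
      have h1 := ih (by omega)
      rw [hor _ _ (by omega)] at h1
      have hn1 : ((-(M : ℤ) + n, (0 : ℤ)) : ℤ × ℤ) ∉ C := fun hc => by
        have := htmin _ hc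
        omega
      have h2 : cutIndicator C K (-(M : ℤ) + n, 0) (-(M : ℤ) + n + 1, 0) = 0 := by
        by_cases e : -(M : ℤ) + n + 1 = t
        · have e' : -(M : ℤ) + n = t - 1 := by omega
          rw [e'] at hn1 ⊢
          simp [cutIndicator, hn1, ht1]
        · refine hzero _ _ hn1 fun hc => ?_
          have := htmin _ hc
          omega
      rw [h2, zero_add] at h1
      rw [← h1]
      ring_nf
  have htM := hlow _ ht
  simp only at htM
  have h1 := hrow (t + M).toNat (by omega)
  have e : -(M : ℤ) + (t + M).toNat = t := by omega
  rw [e, ht_one] at h1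
  exact one_ne_zero h1

/-- A finite cluster of the origin is cut off from infinity by a self-avoiding path of diagonal
adjacency in the complement, which is long if it starts far away. -/
theorem exists_path_of_finite_originCluster {G : Set (ℤ × ℤ)} (hfin : (originCluster G).Finite) :
    ∃ (a : ℕ) (w : ℕ → ℤ × ℤ), w 0 = ((a : ℤ), 0) ∧ (∀ i < a, StarAdj (w i) (w (i + 1))) ∧
      Set.InjOn w {i | i ≤ a} ∧ ∀ i ≤ a, w i ∉ G := by
  by_cases h0 : (0 : ℤ × ℤ) ∈ G
  · obtain ⟨s, t, hs, ht, hsG, hr⟩ := exists_reachable_of_finite_originCluster h0 hfin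
    obtain ⟨p, hp⟩ := hr.exists_isPath
    -- Steps change the abscissa by at most 1 and the path goes from `s + 1` to `t - 1 < 0`, so it
    -- can be cut after `s + 1` steps. The length then equals the abscissa of the starting point,
    -- which makes the paths countable by length alone.
    have hd : ∀ i ≤ p.length, s + 1 - i ≤ (p.getVert i).1 := by
      intro i
      induction i with
      | zero => simp
      | succ i ih =>
        intro hi
        have h1 := ih (by omega)
        have h2 := (p.adj_getVert_succ (i := i) (by omega)).2.1.1
        have h3 := le_abs_self ((p.getVert i).1 - (p.getVert (i + 1)).1)
        push_cast
        omega
    have hlen : s + 1 ≤ p.length := by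
      have := hd p.length le_rfl
      rw [SimpleGraph.Walk.getVert_length] at this
      simp only at this
      omega
    refine ⟨(s + 1).toNat, p.getVert, ?_, ?_, ?_, ?_⟩
    · rw [SimpleGraph.Walk.getVert_zero, Int.toNat_of_nonneg (by omega)]
    · intro i hi
      exact (p.adj_getVert_succ (by omega)).2.1
    · exact hp.getVert_injOn.mono fun i (hi : i ≤ _) => show i ≤ p.length by omega
    · intro i hi
      rcases Nat.eq_zero_or_pos i with rfl | hpos
      · rwa [SimpleGraph.Walk.getVert_zero]
      · have := (p.adj_getVert_succ (i := i - 1) (by omega)).2.2.2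
        rwa [Nat.sub_add_cancel hpos] at this
  · exact ⟨0, fun _ => 0, rfl, by simp, by intro i hi j hj _; simp at hi hj; omega,
      fun _ _ => h0⟩

/-- A finite set of sites has a proportion `1 / N ^ 2` of sites with pairwise distances at
least `N`. -/
theorem exists_separated_subset {N : ℕ} (hN : 0 < N) (S : Finset (ℤ × ℤ)) :
    ∃ T ⊆ S, S.card ≤ N ^ 2 * T.card ∧
      ∀ u ∈ T, ∀ v ∈ T, u ≠ v → (N : ℤ) ≤ |u.1 - v.1| ∨ (N : ℤ) ≤ |u.2 - v.2| := by
  classical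
  have : NeZero N := ⟨hN.ne'⟩
  -- Pigeonhole on residues mod `N`: distinct sites of one class differ by a nonzero multiple of `N`
  -- in some coordinate.
  let f : ℤ × ℤ → ZMod N × ZMod N := fun z => (z.1, z.2)
  have hcard : (Finset.univ : Finset (ZMod N × ZMod N)).card = N ^ 2 := by
    simp [ZMod.card, sq]
  obtain ⟨c, hc, hle⟩ : ∃ c ∈ (Finset.univ : Finset (ZMod N × ZMod N)),
      S.card ≤ N ^ 2 * (S.filter fun z => f z = c).card := by
    by_contra! hcon
    have h1 := Finset.card_eq_sum_card_fiberwise (f := f) (s := S) (t := Finset.univ)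
      (fun _ _ => Finset.mem_univ _)
    have h2 : ∑ c : ZMod N × ZMod N, N ^ 2 * (S.filter fun z => f z = c).card <
        ∑ c : ZMod N × ZMod N, S.card :=
      Finset.sum_lt_sum_of_nonempty Finset.univ_nonempty hcon
    rw [← Finset.mul_sum, ← h1, Finset.sum_const, hcard, smul_eq_mul] at h2
    exact lt_irrefl _ h2
  refine ⟨_, Finset.filter_subset _ _, hle, ?_⟩
  intro u hu v hv huv
  have e : f u = f v := (Finset.mem_filter.1 hu).2.trans (Finset.mem_filter.1 hv).2.symm
  simp only [f, Prod.mk.injEq, ZMod.intCast_eq_intCast_iff_dvd_sub] at e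
  rw [abs_sub_comm u.1, abs_sub_comm u.2]
  by_cases h1 : u.1 = v.1
  · have h2 : v.2 - u.2 ≠ 0 := fun h => huv (Prod.ext h1 (by omega))
    exact Or.inr (Int.le_of_dvd (abs_pos.2 h2) ((dvd_abs _ _).2 e.2))
  · exact Or.inl (Int.le_of_dvd (abs_pos.2 (by omega)) ((dvd_abs _ _).2 e.1))

/-- Peierls' argument: if sites at distance at least `N` are bad independently with small
probability, then the cluster of the origin is infinite with positive probability. -/
theorem not_ae_finite_originCluster {Ω : Type*} [MeasurableSpace Ω] {P : Measure Ω}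
    [IsProbabilityMeasure P] (bad : ℤ × ℤ → Set Ω) {N : ℕ} (hN : 0 < N)
    (h : ∀ T : Finset (ℤ × ℤ), (∀ u ∈ T, ∀ v ∈ T, u ≠ v →
      (N : ℤ) ≤ |u.1 - v.1| ∨ (N : ℤ) ≤ |u.2 - v.2|) →
      P {ω | ∀ z ∈ T, ω ∈ bad z} ≤ ((1 / 18 : ℝ≥0∞) ^ (N ^ 2)) ^ T.card) :
    ¬ ∀ᵐ ω ∂P, (originCluster {z | ω ∉ bad z}).Finite := by
  classical
  intro hae
  have hS : ∀ S : Finset (ℤ × ℤ), P {ω | ∀ z ∈ S, ω ∈ bad z} ≤ (1 / 18 : ℝ≥0∞) ^ S.card := by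
    intro S
    obtain ⟨T, hTS, hcard, hT⟩ := exists_separated_subset hN S
    calc P {ω | ∀ z ∈ S, ω ∈ bad z} ≤ P {ω | ∀ z ∈ T, ω ∈ bad z} :=
          measure_mono fun ω hω z hz => hω z (hTS hz)
      _ ≤ ((1 / 18 : ℝ≥0∞) ^ (N ^ 2)) ^ T.card := h T hT
      _ = (1 / 18 : ℝ≥0∞) ^ (N ^ 2 * T.card) := by rw [pow_mul]
      _ ≤ (1 / 18 : ℝ≥0∞) ^ S.card := by
          refine pow_le_pow_right_of_le_one' ?_ hcard
          rw [one_div]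
          exact ENNReal.inv_le_one.2 (by norm_num)
  -- Nine increments give at most `9 ^ a` paths from `(a, 0)`, each bad with probability at most
  -- `(1/18) ^ (a + 1)`; the total over `a` is at most `1/9`.
  let D : Finset (ℤ × ℤ) := Finset.Icc (-1, -1) (1, 1)
  have hD : D.card = 9 := by decide
  let pos : (a : ℕ) → (Fin a → D) → ℕ → ℤ × ℤ := fun a σ i =>
    ((a : ℤ), 0) + ∑ j ∈ Finset.range i, if hj : j < a then (σ ⟨j, hj⟩ : ℤ × ℤ) else 0
  let E : (a : ℕ) → (Fin a → D) → Set Ω := fun a σ =>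
    {ω | Set.InjOn (pos a σ) {i | i ≤ a} ∧ ∀ i ≤ a, ω ∈ bad (pos a σ i)}
  have hE : ∀ a σ, P (E a σ) ≤ (1 / 18 : ℝ≥0∞) ^ (a + 1) := by
    intro a σ
    by_cases hinj : Set.InjOn (pos a σ) {i | i ≤ a}
    · have hc : ((Finset.range (a + 1)).image (pos a σ)).card = a + 1 := by
        rw [Finset.card_image_of_injOn, Finset.card_range]
        intro i hi j hj hij
        simp only [Finset.coe_range, Set.mem_Iio] at hi hj
        exact hinj (show i ≤ a by omega) (show j ≤ a by omega) hij
      refine (measure_mono ?_).trans ((hS ((Finset.range (a + 1)).image (pos a σ))).trans_eq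
        (by rw [hc]))
      intro ω hω z hz
      obtain ⟨i, hi, rfl⟩ := Finset.mem_image.1 hz
      exact hω.2 i (by simpa [Nat.lt_succ_iff] using hi)
    · have : E a σ = ∅ := by
        ext ω
        simp [E, hinj]
      simp [this]
  have hcover : {ω | (originCluster {z | ω ∉ bad z}).Finite} ⊆ ⋃ a, ⋃ σ, E a σ := by
    intro ω hω
    obtain ⟨a, w, hw0, hstep, hinj, hbad⟩ := exists_path_of_finite_originCluster hω
    have hmem : ∀ i < a, w (i + 1) - w i ∈ D := by
      intro i hi
      obtain ⟨h1, h2⟩ := hstep i hi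
      rw [abs_le] at h1 h2
      simp only [D, Finset.mem_Icc, Prod.le_def, Prod.fst_sub, Prod.snd_sub]
      omega
    let σ : Fin a → D := fun j => ⟨w (j + 1) - w j, hmem j j.2⟩
    have hpos : ∀ i ≤ a, pos a σ i = w i := by
      intro i hi
      have : ∑ j ∈ Finset.range i, (if hj : j < a then (σ ⟨j, hj⟩ : ℤ × ℤ) else 0) =
          ∑ j ∈ Finset.range i, (w (j + 1) - w j) := by
        refine Finset.sum_congr rfl fun j hj => ?_
        rw [dif_pos ((Finset.mem_range.1 hj).trans_le hi)]
      simp only [pos]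
      rw [this, Finset.sum_range_sub, hw0]
      abel
    refine Set.mem_iUnion₂.2 ⟨a, σ, ?_, ?_⟩
    · intro i hi j hj hij
      rw [hpos i hi, hpos j hj] at hij
      exact hinj hi hj hij
    · intro i hi
      rw [hpos i hi]
      simpa using hbad i hi
  have h1 : (1 : ℝ≥0∞) ≤ ∑' a : ℕ, (1 / 18 : ℝ≥0∞) * (1 / 2) ^ a := by
    calc (1 : ℝ≥0∞) = P {ω | (originCluster {z | ω ∉ bad z}).Finite} := by
          rw [measure_congr (eventuallyEq_univ.2 hae), measure_univ]
      _ ≤ P (⋃ a, ⋃ σ, E a σ) := measure_mono hcover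
      _ ≤ ∑' a, P (⋃ σ, E a σ) := measure_iUnion_le _
      _ ≤ ∑' a : ℕ, (1 / 18 : ℝ≥0∞) * (1 / 2) ^ a := by
          refine ENNReal.tsum_le_tsum fun a => ?_
          calc P (⋃ σ, E a σ) ≤ ∑' σ, P (E a σ) := measure_iUnion_le _
            _ = ∑ σ, P (E a σ) := tsum_fintype _
            _ ≤ ∑ σ : Fin a → D, (1 / 18 : ℝ≥0∞) ^ (a + 1) :=
                Finset.sum_le_sum fun σ _ => hE a σ
            _ = (9 : ℝ≥0∞) ^ a * (1 / 18) ^ (a + 1) := by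
                rw [Finset.sum_const, Finset.card_univ, Fintype.card_fun, Fintype.card_coe, hD,
                  Fintype.card_fin, nsmul_eq_mul]
                push_cast
                rfl
            _ = (1 / 18 : ℝ≥0∞) * (1 / 2) ^ a := by
                rw [pow_succ, ← mul_assoc, ← mul_pow, mul_comm]
                congr 2
                rw [show (18 : ℝ≥0∞) = 9 * 2 by norm_num, one_div, one_div,
                  ENNReal.mul_inv (by norm_num) (by norm_num), ← mul_assoc,
                  ENNReal.mul_inv_cancel (by norm_num) (by norm_num), one_mul]
  rw [ENNReal.tsum_mul_left, ENNReal.tsum_geometric] at h1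
  have h2 : (1 - 1 / 2 : ℝ≥0∞) = 2⁻¹ := by rw [one_div, ENNReal.one_sub_inv_two]
  rw [h2, inv_inv, one_div, ← ENNReal.div_eq_inv_mul] at h1
  rw [ENNReal.le_div_iff_mul_le (by norm_num) (by norm_num)] at h1
  norm_num at h1

/-! ### Discretization of space into cells -/

/-- The half-open cubes of side length `1 / q` that tile `ℝ^d`. -/
def cell {d : ℕ} (q : ℕ) (w : Fin d → ℤ) : Set (Space d) :=
  {y | ∀ i, ⌊(q : ℝ) * y i⌋ = w i}

theorem mem_cell_iff {d q : ℕ} {w : Fin d → ℤ} {y : Space d} :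
    y ∈ cell q w ↔ ∀ i, (w i : ℝ) ≤ q * y i ∧ q * y i < w i + 1 := by
  simp only [cell, Set.mem_ofPred_eq, Int.floor_eq_iff]

theorem measurableSet_cell {d : ℕ} (q : ℕ) (w : Fin d → ℤ) : MeasurableSet (cell q w) := by
  have : cell q w = ⋂ i, (fun y : Space d => ⌊(q : ℝ) * y i⌋) ⁻¹' {w i} := by
    ext y
    simp [cell]
  rw [this]
  refine MeasurableSet.iInter fun i => ?_
  have h : Measurable fun y : Space d => ⌊(q : ℝ) * y i⌋ :=
    Int.measurable_floor.comp (by fun_prop)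
  exact h (measurableSet_singleton _)

theorem measurableSet_cube {d : ℕ} (s : ℝ) (x : Space d) : MeasurableSet (cube s x) := by
  have : cube s x = ⋂ i, {y : Space d | |y i - x i| ≤ s / 2} := by
    ext y
    simp [cube]
  rw [this]
  exact MeasurableSet.iInter fun i => measurableSet_le (by fun_prop) measurable_const

theorem disjoint_cell {d q : ℕ} {v w : Fin d → ℤ} (h : v ≠ w) :
    Disjoint (cell q v : Set (Space d)) (cell q w) := by
  rw [Set.disjoint_left]
  intro y hv hw
  exact h (funext fun i => (hv i).symm.trans (hw i))

theorem abs_sub_lt_of_mem_cell {d q : ℕ} (hq : 0 < q) {v w : Fin d → ℤ} {x y : Space d}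
    (hx : x ∈ cell q v) (hy : y ∈ cell q w) {m : ℤ} (i : Fin d) (h : |v i - w i| ≤ m) :
    |x i - y i| < (m + 1) / q := by
  have hq' : (0 : ℝ) < q := by exact_mod_cast hq
  have hx' := mem_cell_iff.1 hx i
  have hy' := mem_cell_iff.1 hy i
  have h' : |(v i : ℝ) - w i| ≤ m := by exact_mod_cast h
  rw [lt_div_iff₀ hq']
  rw [abs_le] at h'
  rw [← abs_of_pos hq', ← abs_mul, abs_lt]
  constructor <;> nlinarith

/-- Coordinates differ by less than `4 / q`, and bounding `√d` by `d` gives a distance of at most `4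
* d / q`. -/
theorem dist_lt_of_mem_cell {d q : ℕ} (hq : 0 < q) {r : ℝ} (hr : 0 < r) (hqr : 4 * d < r * q)
    {v w : Fin d → ℤ} {x y : Space d} (hx : x ∈ cell q v) (hy : y ∈ cell q w)
    (h : ∀ i, |v i - w i| ≤ 3) : dist x y < r := by
  have hq' : (0 : ℝ) < q := by exact_mod_cast hq
  rw [EuclideanSpace.dist_eq, Real.sqrt_lt' hr]
  have h1 : ∀ i, dist (x i) (y i) ^ 2 ≤ (4 / q : ℝ) ^ 2 := by
    intro i
    have := (abs_sub_lt_of_mem_cell hq hx hy i (h i)).le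
    norm_num at this
    rw [Real.dist_eq]
    exact pow_le_pow_left₀ (abs_nonneg _) this 2
  calc ∑ i, dist (x i) (y i) ^ 2 ≤ ∑ i : Fin d, (4 / q : ℝ) ^ 2 :=
        Finset.sum_le_sum fun i _ => h1 i
    _ = d * (4 / q : ℝ) ^ 2 := by simp
    _ ≤ (d * (4 / q : ℝ)) ^ 2 := by
        rw [mul_pow]
        refine mul_le_mul_of_nonneg_right ?_ (sq_nonneg _)
        exact_mod_cast Nat.le_self_pow two_ne_zero d
    _ < r ^ 2 := by
        refine pow_lt_pow_left₀ ?_ (by positivity) two_ne_zero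
        rw [mul_div_assoc', div_lt_iff₀ hq']
        linarith

theorem isBounded_cell {d q : ℕ} (hq : 0 < q) (w : Fin d → ℤ) :
    Bornology.IsBounded (cell q w : Set (Space d)) := by
  have hq' : (0 : ℝ) < q := by exact_mod_cast hq
  refine Metric.isBounded_iff.2 ⟨4 * d + 1, fun x hx y hy => ?_⟩
  refine (dist_lt_of_mem_cell hq (r := 4 * d + 1) (by positivity) ?_ hx hy (by simp)).le
  have : (1 : ℝ) ≤ q := by exact_mod_cast hq
  have hd : (0 : ℝ) ≤ d := by positivity
  nlinarith

theorem iUnion_cell {d : ℕ} (q : ℕ) : ⋃ w : Fin d → ℤ, (cell q w : Set (Space d)) = Set.univ := by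
  ext y
  simp only [Set.mem_iUnion, Set.mem_univ, iff_true]
  exact ⟨fun i => ⌊(q : ℝ) * y i⌋, fun i => rfl⟩

/-- Every cell of positive mass of a counting measure contains a point. -/
theorem IsCountingMeasure.exists_mem_points {d : ℕ} {ξ : Measure (Space d)}
    (hξ : IsCountingMeasure ξ) {B : Set (Space d)} (hB : MeasurableSet B)
    (hBb : Bornology.IsBounded B) (h : ξ B ≠ 0) : ∃ x ∈ B, x ∈ points ξ := by
  obtain ⟨x, hxB, hx⟩ := Measure.nonempty_inter_support_of_pos (μ := ξ.restrict B) (s := B)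
    (by rw [Measure.restrict_apply_self]; exact pos_iff_ne_zero.2 h)
  refine ⟨x, hxB, ?_⟩
  rw [Measure.mem_support_iff_forall] at hx
  -- Positive integer masses are at least 1. This bound survives the limit of shrinking balls, so
  -- the support point is an atom.
  have hball : ∀ n : ℕ, 1 ≤ ξ (Metric.closedBall x (1 / (n + 1)) ∩ B) := by
    intro n
    have h1 := hx _ (Metric.closedBall_mem_nhds x (Nat.one_div_pos_of_nat (n := n)))
    rw [Measure.restrict_apply Metric.isClosed_closedBall.measurableSet] at h1
    obtain ⟨k, hk⟩ := hξ (Metric.closedBall x (1 / (n + 1)) ∩ B)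
      (Metric.isClosed_closedBall.measurableSet.inter hB) (hBb.subset Set.inter_subset_right)
    rw [hk] at h1 ⊢
    exact_mod_cast h1
  have hlim := tendsto_measure_iInter_atTop (μ := ξ)
    (s := fun n : ℕ => Metric.closedBall x (1 / (n + 1)) ∩ B)
    (fun n => (Metric.isClosed_closedBall.measurableSet.inter hB).nullMeasurableSet)
    (fun m n hmn => Set.inter_subset_inter_left _
      (Metric.closedBall_subset_closedBall (Nat.one_div_le_one_div hmn)))
    ⟨0, by
      obtain ⟨k, hk⟩ := hξ (Metric.closedBall x (1 / ((0 : ℕ) + 1)) ∩ B)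
        (Metric.isClosed_closedBall.measurableSet.inter hB) (hBb.subset Set.inter_subset_right)
      simp only [hk]
      exact ENNReal.natCast_ne_top k⟩
  have hsub : ⋂ n : ℕ, Metric.closedBall x (1 / ((n : ℝ) + 1)) ∩ B ⊆ {x} := by
    intro y hy
    have h1 : ∀ n : ℕ, dist y x ≤ 1 / (n + 1) := fun n => (Set.mem_iInter.1 hy n).1
    have h2 : dist y x ≤ 0 :=
      ge_of_tendsto' tendsto_one_div_add_atTop_nhds_zero_nat h1
    exact dist_le_zero.1 h2
  have h1 : 1 ≤ ξ {x} := (ge_of_tendsto' hlim hball).trans (measure_mono hsub)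
  exact ne_of_gt (zero_lt_one.trans_le h1)

/-! ### Windows and good sites -/

/-- The indices of the cells in the window of a site. -/
abbrev Window (d b : ℕ) : Type :=
  ↥(Finset.Icc (fun _ : Fin d => -(11 * b : ℤ)) (fun _ => (11 * b : ℤ)))

theorem Window.abs_le {d b : ℕ} (v : Window d b) (i : Fin d) : |v.1 i| ≤ 11 * b := by
  have := Finset.mem_Icc.1 v.2
  exact _root_.abs_le.2 ⟨this.1 i, this.2 i⟩

/-- The set `O` of occupied cells has a cell in the inner part of the window, and all its cells in
the middle part are joined by chains of occupied cells. -/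
def GoodPattern {d b : ℕ} (O : Set (Window d b)) : Prop :=
  (∃ v ∈ O, ∀ i, |v.1 i| ≤ b) ∧
  ∀ v ∈ O, ∀ w ∈ O, (∀ i, |v.1 i| ≤ 4 * b) → (∀ i, |w.1 i| ≤ 4 * b) →
    Relation.ReflTransGen (fun x y : Window d b => y ∈ O ∧ ∀ i, |x.1 i - y.1 i| ≤ 3) v w

/-- The embedding of `ℤ²` as a coordinate plane of `ℤ^d`. -/
def planar (d : ℕ) (z : ℤ × ℤ) (i : Fin d) : ℤ :=
  if i.val = 0 then z.1 else if i.val = 1 then z.2 else 0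

/-- The index of the cell `v` in the window of the site `z`. -/
def cellIndex {d : ℕ} (b : ℕ) (z : ℤ × ℤ) (v : Fin d → ℤ) (i : Fin d) : ℤ :=
  v i + 3 * b * planar d z i

/-- The masses of the cells in the window of the site `z`. -/
def windowMass {d : ℕ} (q b : ℕ) (z : ℤ × ℤ) (μ : Measure (Space d)) (v : Window d b) : ℝ≥0∞ :=
  μ (cell q (cellIndex b z v.1))

/-- The site `z` is good: the cells charged by `μ` form a good pattern, and all of them contain
points of `ξ`. -/
def GoodSite {d : ℕ} (q b : ℕ) (μ ξ : Measure (Space d)) (z : ℤ × ℤ) : Prop :=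
  GoodPattern {v | windowMass q b z μ v ≠ 0} ∧
    ∀ v, windowMass q b z μ v ≠ 0 → windowMass q b z ξ v ≠ 0

/-- A support point on the face of its half-open cell need not make that cell charged. But its
neighbourhood of radius `1 / q` has positive mass and meets only cells with indices within 1, so one
of these is charged. -/
theorem exists_cell_of_mem_support {d q : ℕ} (hq : 0 < q) {μ : Measure (Space d)}
    {Q : Set (Space d)} {p : Space d} (hp : p ∈ (μ.restrict Q).support) :
    ∃ w : Fin d → ℤ, μ (cell q w) ≠ 0 ∧ (cell q w ∩ Q).Nonempty ∧
      ∀ i, |⌊(q : ℝ) * p i⌋ - w i| ≤ 1 := by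
  have hq' : (0 : ℝ) < q := by exact_mod_cast hq
  set U : Set (Space d) := {y | ∀ i, |y i - p i| < 1 / q} with hU
  have hUo : IsOpen U := by
    have : U = ⋂ i, {y : Space d | |y i - p i| < 1 / q} := by ext; simp [hU]
    rw [this]
    exact isOpen_iInter_of_finite fun i => isOpen_lt (by fun_prop) continuous_const
  have hpos := (Measure.mem_support_iff_forall p).1 hp U
    (hUo.mem_nhds (fun i => by simpa using hq))
  obtain ⟨w, hw⟩ : ∃ w : Fin d → ℤ, (μ.restrict Q) (U ∩ cell q w) ≠ 0 := by
    by_contra! hcon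
    have h1 := measure_iUnion_null hcon
    rw [← Set.inter_iUnion, iUnion_cell, Set.inter_univ] at h1
    exact hpos.ne' h1
  have hcQ : μ (cell q w ∩ Q) ≠ 0 := by
    rw [← Measure.restrict_apply (measurableSet_cell q w)]
    exact fun h => hw (measure_mono_null Set.inter_subset_right h)
  refine ⟨w, fun h => hcQ (measure_mono_null Set.inter_subset_left h),
    nonempty_of_measure_ne_zero hcQ, ?_⟩
  obtain ⟨y, hyU, hyw⟩ := nonempty_of_measure_ne_zero hw
  intro i
  have h1 := hyU i
  rw [lt_div_iff₀ hq', ← abs_of_pos hq', ← abs_mul, abs_lt] at h1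
  have h2 := mem_cell_iff.1 hyw i
  have h3 := Int.floor_le ((q : ℝ) * p i)
  have h4 := Int.lt_floor_add_one ((q : ℝ) * p i)
  have h5 : (⌊(q : ℝ) * p i⌋ : ℝ) - w i < 2 := by nlinarith
  have h6 : (w i : ℝ) - ⌊(q : ℝ) * p i⌋ < 2 := by nlinarith
  have h7 : ⌊(q : ℝ) * p i⌋ - w i < 2 := by exact_mod_cast h5
  have h8 : w i - ⌊(q : ℝ) * p i⌋ < 2 := by exact_mod_cast h6
  rw [_root_.abs_le]
  omega

theorem abs_index_le_of_inter_cube {d q : ℕ} {w : Fin d → ℤ} {s : ℝ} {m : ℤ}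
    (h : (cell q w ∩ cube s (0 : Space d)).Nonempty) (hm : q * (s / 2) + 1 ≤ m) (i : Fin d) :
    |w i| ≤ m := by
  obtain ⟨y, hyw, hys⟩ := h
  have h1 := mem_cell_iff.1 hyw i
  have h2 : |y i - (0 : Space d) i| ≤ s / 2 := hys i
  have h0 : (0 : ℝ) ≤ q := by positivity
  simp only [PiLp.zero_apply, sub_zero, _root_.abs_le] at h2
  have h3 : |(w i : ℝ)| ≤ m := by
    rw [_root_.abs_le]
    constructor <;> nlinarith
  exact_mod_cast h3

theorem cell_subset_cube {d q : ℕ} (hq : 0 < q) {w : Fin d → ℤ} {x : Space d} {s : ℝ} {m : ℝ}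
    (h : ∀ i, |(w i : ℝ) - q * x i| ≤ m) (hm : m + 1 ≤ q * (s / 2)) :
    cell q w ⊆ cube s x := by
  intro y hy i
  have hq' : (0 : ℝ) < q := by exact_mod_cast hq
  have h1 := mem_cell_iff.1 hy i
  have h2 := _root_.abs_le.1 (h i)
  rw [_root_.abs_le]
  constructor <;> nlinarith

/-- Connectedness of the support on a large cube makes the pattern of charged cells good. -/
theorem goodPattern_of_support {d q k : ℕ} (hq : 0 < q) (hk : 2 ≤ k) (μ : Measure (Space d))
    (hne : (μ.restrict (cube k 0)).support.Nonempty)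
    (hconn : ∃ x ∈ (μ.restrict (cube (20 * k) 0)).support,
      (μ.restrict (cube (10 * k) 0)).support ⊆
        connectedComponentIn (μ.restrict (cube (20 * k) 0)).support x) :
    GoodPattern {v : Window d (q * k) | windowMass q (q * k) 0 μ v ≠ 0} := by
  have hq' : (1 : ℝ) ≤ q := by exact_mod_cast hq
  have hk' : (2 : ℝ) ≤ k := by exact_mod_cast hk
  have hqk : (2 : ℝ) ≤ q * k := by nlinarith
  have hidx : ∀ v : Fin d → ℤ, cellIndex (q * k) 0 v = v := by
    intro v
    ext i
    simp [cellIndex, planar]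
  have hmass : ∀ v : Window d (q * k), windowMass q (q * k) 0 μ v = μ (cell q v.1) := fun v => by
    rw [windowMass, hidx]
  have toWin : ∀ (w : Fin d → ℤ), (∀ i, |w i| ≤ 11 * (q * k : ℕ)) →
      w ∈ Finset.Icc (fun _ : Fin d => -(11 * (q * k : ℕ) : ℤ)) (fun _ => (11 * (q * k : ℕ) : ℤ)) :=
    fun w hw => Finset.mem_Icc.2
      ⟨fun i => (_root_.abs_le.1 (hw i)).1, fun i => (_root_.abs_le.1 (hw i)).2⟩
  constructor
  · obtain ⟨p, hp⟩ := hne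
    obtain ⟨w, hw0, hwQ, -⟩ := exists_cell_of_mem_support hq hp
    have hb : ∀ i, |w i| ≤ (q * k : ℕ) := abs_index_le_of_inter_cube hwQ (by push_cast; nlinarith)
    refine ⟨⟨w, toWin w fun i => (hb i).trans (by omega)⟩, ?_, hb⟩
    simp only [Set.mem_ofPred_eq, hmass]
    exact hw0
  · obtain ⟨x, hx, hsub⟩ := hconn
    set W := (μ.restrict (cube (20 * k) 0)).support with hW
    set O := {v : Window d (q * k) | windowMass q (q * k) 0 μ v ≠ 0} with hO
    have near_ex : ∀ p ∈ W, ∃ v ∈ O, ∀ i, |⌊(q : ℝ) * p i⌋ - v.1 i| ≤ 1 := by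
      intro p hp
      obtain ⟨w, hw0, hwQ, hw⟩ := exists_cell_of_mem_support hq hp
      have hb : ∀ i, |w i| ≤ 11 * (q * k : ℕ) :=
        abs_index_le_of_inter_cube hwQ (by push_cast; nlinarith)
      refine ⟨⟨w, toWin w hb⟩, ?_, hw⟩
      simp only [hO, Set.mem_ofPred_eq, hmass]
      exact hw0
    -- `Rel` holds locally, since index errors add up to `1 + 1 + 1 = 3`, and it is transitive,
    -- since `near_ex` supplies a cell at the intermediate point. A relation of this kind holds
    -- throughout a preconnected set.
    let Rel : Space d → Space d → Prop := fun p p' => ∀ v ∈ O, ∀ w ∈ O,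
      (∀ i, |⌊(q : ℝ) * p i⌋ - v.1 i| ≤ 1) → (∀ i, |⌊(q : ℝ) * p' i⌋ - w.1 i| ≤ 1) →
      Relation.ReflTransGen (fun x y : Window d (q * k) => y ∈ O ∧ ∀ i, |x.1 i - y.1 i| ≤ 3) v w
    have hRel : ∀ p ∈ connectedComponentIn W x, ∀ p' ∈ connectedComponentIn W x, Rel p p' := by
      intro p hp p' hp'
      refine isPreconnected_connectedComponentIn.induction₂' Rel ?_ ?_ hp hp'
      · intro a _
        have hU : {y : Space d | ∀ i, |y i - a i| < 1 / q} ∈ 𝓝 a := by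
          have e : {y : Space d | ∀ i, |y i - a i| < 1 / q} =
              ⋂ i, {y : Space d | |y i - a i| < 1 / q} := by ext; simp
          rw [e]
          refine (isOpen_iInter_of_finite fun i =>
            isOpen_lt (by fun_prop) continuous_const).mem_nhds ?_
          simp only [Set.mem_iInter, Set.mem_ofPred_eq, sub_self, abs_zero]
          intro _
          positivity
        filter_upwards [mem_nhdsWithin_of_mem_nhds hU] with y hy
        have hfl : ∀ i, |⌊(q : ℝ) * a i⌋ - ⌊(q : ℝ) * y i⌋| ≤ 1 := by
          intro i
          have hq0 : (0 : ℝ) < q := by linarith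
          have h1 := hy i
          rw [lt_div_iff₀ hq0, ← abs_of_pos hq0, ← abs_mul, abs_lt] at h1
          have h3 := Int.floor_le ((q : ℝ) * a i)
          have h4 := Int.lt_floor_add_one ((q : ℝ) * a i)
          have h3' := Int.floor_le ((q : ℝ) * y i)
          have h4' := Int.lt_floor_add_one ((q : ℝ) * y i)
          have h5 : (⌊(q : ℝ) * a i⌋ : ℝ) - ⌊(q : ℝ) * y i⌋ < 2 := by nlinarith
          have h6 : (⌊(q : ℝ) * y i⌋ : ℝ) - ⌊(q : ℝ) * a i⌋ < 2 := by nlinarith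
          have h7 : ⌊(q : ℝ) * a i⌋ - ⌊(q : ℝ) * y i⌋ < 2 := by exact_mod_cast h5
          have h8 : ⌊(q : ℝ) * y i⌋ - ⌊(q : ℝ) * a i⌋ < 2 := by exact_mod_cast h6
          rw [_root_.abs_le]
          omega
        constructor <;>
        · intro v hv w hw hva hwy
          refine Relation.ReflTransGen.single ⟨hw, fun i => ?_⟩
          have h1 := _root_.abs_le.1 (hva i)
          have h2 := _root_.abs_le.1 (hwy i)
          have h3 := _root_.abs_le.1 (hfl i)
          rw [_root_.abs_le]
          omega
      · intro a c e _ hc _ hac hce v hv w hw hva hwe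
        obtain ⟨u, hu, huc⟩ := near_ex c (connectedComponentIn_subset _ _ hc)
        exact (hac v hv u hu hva huc).trans (hce u hu w hw huc hwe)
    -- Since `4 * q * k + 1 ≤ 5 * q * k`, such a cell lies in the cube of side `10 * k`, whose
    -- support is inside the component.
    have point : ∀ v ∈ O, (∀ i, |v.1 i| ≤ 4 * (q * k : ℕ)) →
        ∃ p ∈ connectedComponentIn W x, ∀ i, |⌊(q : ℝ) * p i⌋ - v.1 i| ≤ 1 := by
      intro v hv hvb
      have hcQ : cell q v.1 ⊆ cube (10 * k) (0 : Space d) := by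
        refine cell_subset_cube hq (m := 4 * (q * k)) (fun i => ?_) (by nlinarith)
        have := hvb i
        simp only [PiLp.zero_apply, mul_zero, sub_zero]
        exact_mod_cast this
      have hpos : 0 < (μ.restrict (cube (10 * k) 0)) (cell q v.1) := by
        rw [Measure.restrict_apply (measurableSet_cell _ _), Set.inter_eq_left.2 hcQ,
          pos_iff_ne_zero, ← hmass]
        exact hv
      obtain ⟨p, hpv, hp⟩ := Measure.nonempty_inter_support_of_pos hpos
      refine ⟨p, hsub hp, fun i => ?_⟩
      rw [hpv i]
      simp
    intro v hv w hw hvb hwb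
    obtain ⟨p, hp, hpv⟩ := point v hv hvb
    obtain ⟨p', hp', hpw⟩ := point w hw hwb
    exact hRel p hp p' hp' v hv w hw hpv hpw

/-! ### Percolation of good sites -/

theorem abs_planar_sub_le {d : ℕ} {z z' : ℤ × ℤ} (h : StarAdj z z') (i : Fin d) :
    |planar d z' i - planar d z i| ≤ 1 := by
  obtain ⟨h1, h2⟩ := h
  rw [abs_sub_comm] at h1 h2
  unfold planar
  split_ifs <;> simp [h1, h2]

theorem gilbertGraph_reachable {d q b : ℕ} (hq : 0 < q) {r : ℝ} (hr : 0 < r)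
    (hqr : 4 * d < r * q) {ξ : Measure (Space d)} (hξ : IsCountingMeasure ξ) (z : ℤ × ℤ)
    {O : Set (Window d b)} (hO : ∀ v ∈ O, windowMass q b z ξ v ≠ 0) {v w : Window d b}
    (hv : v ∈ O)
    (hvw : Relation.ReflTransGen (fun x y : Window d b => y ∈ O ∧ ∀ i, |x.1 i - y.1 i| ≤ 3) v w)
    (x : points ξ) (hx : (x : Space d) ∈ cell q (cellIndex b z v.1)) :
    ∀ y : points ξ, (y : Space d) ∈ cell q (cellIndex b z w.1) →
      (gilbertGraph r ξ).Reachable x y := by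
  have close : ∀ (x y : points ξ) (u u' : Window d b), (∀ i, |u.1 i - u'.1 i| ≤ 3) →
      (x : Space d) ∈ cell q (cellIndex b z u.1) →
      (y : Space d) ∈ cell q (cellIndex b z u'.1) → (gilbertGraph r ξ).Reachable x y := by
    intro x y u u' huu' hx hy
    by_cases e : x = y
    · rw [e]
    · refine SimpleGraph.Adj.reachable ⟨e, dist_lt_of_mem_cell hq hr hqr hx hy fun i => ?_⟩
      simpa [cellIndex] using huu' i
  have hmem : ∀ {u}, Relation.ReflTransGen
      (fun x y : Window d b => y ∈ O ∧ ∀ i, |x.1 i - y.1 i| ≤ 3) v u → u ∈ O := by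
    intro u hu
    induction hu with
    | refl => exact hv
    | tail _ h _ => exact h.1
  induction hvw with
  | refl => exact fun y hy => close x y v v (by simp) hx hy
  | @tail u u' hu huu' ih =>
    intro y hy
    obtain ⟨p, hp, hpξ⟩ := hξ.exists_mem_points (measurableSet_cell _ _) (isBounded_cell hq _)
      (hO u (hmem hu))
    exact (ih ⟨p, hpξ⟩ hp).trans (close _ _ u u' huu'.2 hp hy)

/-- An infinite cluster of good sites yields an infinite component of the Gilbert graph. -/
theorem percolates_of_infinite_originCluster {d q b : ℕ} (hd : 2 ≤ d) (hq : 0 < q) (hb : 0 < b)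
    {r : ℝ} (hr : 0 < r) (hqr : 4 * d < r * q) {μ ξ : Measure (Space d)}
    (hξ : IsCountingMeasure ξ) (h : (originCluster {z | GoodSite q b μ ξ z}).Infinite) :
    Percolates r ξ := by
  set G := {z | GoodSite q b μ ξ z} with hG
  have hex : ∀ z : G, ∃ (v : Window d b) (x : points ξ), windowMass q b z μ v ≠ 0 ∧
      (∀ i, |v.1 i| ≤ b) ∧ (x : Space d) ∈ cell q (cellIndex b z v.1) := by
    rintro ⟨z, hz⟩
    obtain ⟨v, hv, hvb⟩ := hz.1.1
    obtain ⟨p, hp, hpξ⟩ := hξ.exists_mem_points (measurableSet_cell _ _) (isBounded_cell hq _)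
      (hz.2 v hv)
    exact ⟨v, ⟨p, hpξ⟩, hv, hvb, hp⟩
  choose v x hv hvb hx using hex
  have hlink : ∀ z z' : G, StarAdj z z' → (gilbertGraph r ξ).Reachable (x z) (x z') := by
    intro z z' hzz'
    -- Seen from `z`, the inner cell of a neighbour has index at most `b + 3 * b`, which is the size
    -- of the middle part.
    have hw4 : ∀ i, |(v z').1 i + 3 * b * (planar d z' i - planar d z i)| ≤ 4 * b := by
      intro i
      have h1 := hvb z' i
      have h2 := abs_planar_sub_le hzz' i
      rw [_root_.abs_le] at *
      constructor <;> nlinarith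
    let w : Window d b := ⟨fun i => (v z').1 i + 3 * b * (planar d z' i - planar d z i),
      Finset.mem_Icc.2 ⟨fun i => by have := _root_.abs_le.1 (hw4 i); simp only; omega,
        fun i => by have := _root_.abs_le.1 (hw4 i); simp only; omega⟩⟩
    have hidx : cellIndex b z w.1 = cellIndex b z' (v z').1 := by
      ext i
      simp only [cellIndex, w]
      ring
    have hw : windowMass q b z μ w ≠ 0 := by
      rw [windowMass, hidx]
      exact hv z'
    have hchain := z.2.1.2 (v z) (hv z) w hw (fun i => (hvb z i).trans (by omega)) hw4
    refine gilbertGraph_reachable hq hr hqr hξ z (O := {v | windowMass q b z μ v ≠ 0})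
      z.2.2 (hv z) hchain (x z) (hx z) (x z') ?_
    rw [hidx]
    exact hx z'
  -- Inner blocks have index radius `b` and spacing `3 * b`, so different sites cannot share a cell.
  have hinj : Function.Injective x := by
    intro z z' hzz'
    have h1 := hx z
    rw [hzz'] at h1
    have h2 : ∀ i, cellIndex b z (v z).1 i = cellIndex b z' (v z').1 i :=
      fun i => (h1 i).symm.trans (hx z' i)
    have h3 : ∀ i, planar d z i = planar d z' i := by
      intro i
      have e := h2 i
      simp only [cellIndex] at e
      have b1 := _root_.abs_le.1 (hvb z i)
      have b2 := _root_.abs_le.1 (hvb z' i)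
      have hb' : (0 : ℤ) < b := by exact_mod_cast hb
      have u1 : planar d z i - planar d z' i < 1 := by nlinarith
      have u2 : planar d z' i - planar d z i < 1 := by nlinarith
      omega
    have e0 := h3 ⟨0, by omega⟩
    have e1 := h3 ⟨1, by omega⟩
    simp [planar] at e0 e1
    exact Subtype.ext (Prod.ext e0 e1)
  have h0 : (0 : ℤ × ℤ) ∈ G := by
    obtain ⟨z, hz⟩ := h.nonempty
    exact hz.1
  have hreach : ∀ z (hz : z ∈ originCluster G),
      (gilbertGraph r ξ).Reachable (x ⟨0, h0⟩) (x ⟨z, originCluster_subset G hz⟩) := by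
    rintro z ⟨hz0, hz⟩
    induction hz with
    | refl => exact SimpleGraph.Reachable.refl _
    | @tail u u' hu huu' ih => exact ih.trans (hlink _ _ huu'.2.starAdj)
  refine ⟨(gilbertGraph r ξ).connectedComponentMk (x ⟨0, h0⟩), ?_⟩
  have : Infinite (originCluster G) := h.to_subtype
  refine (Set.infinite_range_of_injective (f := fun z : originCluster G =>
    x ⟨z, originCluster_subset G z.2⟩) ?_).mono ?_
  · intro z z' e
    exact Subtype.ext (Subtype.mk.inj (hinj e))
  · rintro _ ⟨z, rfl⟩
    exact SimpleGraph.ConnectedComponent.eq.2 (hreach z z.2).symm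

/-! ### The conditional probability that a site is good -/

/-- The probability that a Poisson variable with parameter `l * t` does not vanish, set to `1` if
`t = 0`. -/
def hitProb (l : ℝ≥0) (t : ℝ≥0∞) : ℝ≥0 :=
  if t = 0 then 1 else 1 - Real.toNNReal (Real.exp (-(l * t.toNNReal : ℝ≥0)))

open Classical in
/-- The probability that a site whose cells have masses `a` is good. -/
def goodProb {d b : ℕ} (l : ℝ≥0) (a : Window d b → ℝ≥0∞) : ℝ≥0 :=
  if GoodPattern {v | a v ≠ 0} then ∏ v, hitProb l (a v) else 0

theorem hitProb_le_one (l : ℝ≥0) (t : ℝ≥0∞) : hitProb l t ≤ 1 := by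
  unfold hitProb
  split_ifs
  · exact le_rfl
  · exact tsub_le_self

theorem measurable_hitProb (l : ℝ≥0) : Measurable (hitProb l) := by
  unfold hitProb
  refine Measurable.ite (measurableSet_singleton 0) measurable_const ?_
  refine Measurable.const_sub ?_ _
  refine measurable_real_toNNReal.comp (Real.measurable_exp.comp ?_)
  exact ((ENNReal.measurable_toNNReal.const_mul l).coe_nnreal_real).neg

/-- Finiteness matters: `toNNReal` sends `∞` to 0, so `hitProb l ∞ = 0` for every `l`. -/
theorem tendsto_hitProb {t : ℝ≥0∞} (ht : t ≠ ∞) :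
    Tendsto (fun l : ℕ => hitProb l t) atTop (𝓝 1) := by
  unfold hitProb
  by_cases h : t = 0
  · simp [h]
  · simp only [h, if_false]
    have hpos : 0 < t.toNNReal := ENNReal.toNNReal_pos h ht
    have h1 : Tendsto (fun l : ℕ => ((l : ℝ≥0) * t.toNNReal : ℝ≥0) |>.toReal) atTop atTop := by
      push_cast
      exact tendsto_natCast_atTop_atTop.atTop_mul_const (by exact_mod_cast hpos)
    have h2 := Real.tendsto_exp_neg_atTop_nhds_zero.comp h1
    have h3 := (continuous_real_toNNReal.tendsto 0).comp h2
    have h4 : Tendsto (fun l : ℕ => (1 : ℝ≥0) -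
        Real.toNNReal (Real.exp (-((l : ℝ≥0) * t.toNNReal : ℝ≥0)))) atTop
        (𝓝 (1 - Real.toNNReal 0)) := tendsto_const_nhds.sub h3
    simpa using h4

theorem goodProb_le_one {d b : ℕ} (l : ℝ≥0) (a : Window d b → ℝ≥0∞) : goodProb l a ≤ 1 := by
  unfold goodProb
  split_ifs
  · exact Finset.prod_le_one' fun v _ => hitProb_le_one l (a v)
  · exact zero_le_one

theorem measurableSet_goodPattern (d b : ℕ) :
    MeasurableSet {a : Window d b → ℝ≥0∞ | GoodPattern {v | a v ≠ 0}} := by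
  have h : Measurable fun (a : Window d b → ℝ≥0∞) (v : Window d b) => a v ≠ 0 := by
    refine measurable_pi_lambda _ fun v => ?_
    refine measurableSet_setOfPred.1 ?_
    exact (measurableSet_eq_fun (measurable_pi_apply v) measurable_const).compl
  exact h (MeasurableSet.of_discrete (s := {O : Window d b → Prop | GoodPattern {v | O v}}))

theorem measurable_goodProb {d b : ℕ} (l : ℝ≥0) :
    Measurable (goodProb l : (Window d b → ℝ≥0∞) → ℝ≥0) := by
  unfold goodProb
  refine Measurable.ite (measurableSet_goodPattern d b) ?_ measurable_const
  exact Finset.measurable_prod _ fun v _ =>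
    (measurable_hitProb l).comp (measurable_pi_apply v)

theorem measurable_windowMass {d : ℕ} (q b : ℕ) (z : ℤ × ℤ) :
    Measurable (windowMass q b z : Measure (Space d) → Window d b → ℝ≥0∞) :=
  measurable_pi_lambda _ fun _ => Measure.measurable_coe (measurableSet_cell _ _)

/-- Windows emptied by a restriction contribute nothing, which lets one function serve all sites in
`IsStabilizationField.lintegral_prod_le`. -/
theorem goodProb_zero {d b : ℕ} (l : ℝ≥0) : goodProb l (0 : Window d b → ℝ≥0∞) = 0 := by
  unfold goodProb
  rw [if_neg]
  rintro ⟨⟨v, hv, -⟩, -⟩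
  exact hv rfl

theorem poissonMeasure_hit (l : ℝ≥0) (t : ℝ≥0∞) :
    poissonMeasure (l * t.toNNReal) {m | t ≠ 0 → m ≠ 0} = hitProb l t := by
  unfold hitProb
  split_ifs with h
  · simp [h]
  · have : {m : ℕ | t ≠ 0 → m ≠ 0} = {0}ᶜ := by
      ext m
      simp [h]
    rw [this, prob_compl_eq_one_sub (measurableSet_singleton 0), poissonMeasure_singleton]
    simp [ENNReal.ofReal]

theorem pi_poissonMeasure_not_good {d b : ℕ} (l : ℝ≥0) (a : Window d b → ℝ≥0∞) :
    Measure.pi (fun v => poissonMeasure (l * (a v).toNNReal))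
      {m | ¬ (GoodPattern {v | a v ≠ 0} ∧ ∀ v, a v ≠ 0 → m v ≠ 0)} = 1 - goodProb l a := by
  unfold goodProb
  split_ifs with h
  · have : {m : Window d b → ℕ | ¬ (GoodPattern {v | a v ≠ 0} ∧ ∀ v, a v ≠ 0 → m v ≠ 0)} =
        (Set.univ.pi fun v => {n : ℕ | a v ≠ 0 → n ≠ 0})ᶜ := by
      ext m
      simp [h]
    rw [this, prob_compl_eq_one_sub (MeasurableSet.of_discrete), Measure.pi_pi]
    simp only [poissonMeasure_hit]
    push_cast
    rfl
  · simp [h]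

/-- Given the intensity measure, sites with disjoint windows are good independently. -/
theorem IsCoxProcess.measure_forall_not_goodSite_le {d : ℕ} {Ω : Type*} [MeasurableSpace Ω]
    {P : Measure Ω} {Λ X : Ω → Measure (Space d)} {l : ℝ≥0} (hX : IsCoxProcess P Λ l X)
    (hΛ : Measurable Λ) {q b : ℕ} (hq : 0 < q) (T : Finset (ℤ × ℤ))
    (hT : ∀ z ∈ T, ∀ z' ∈ T, ∀ v v' : Window d b,
      cellIndex b z v.1 = cellIndex b z' v'.1 → z = z' ∧ v = v') :
    P {ω | ∀ z ∈ T, ¬ GoodSite q b (Λ ω) (X ω) z} ≤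
      ∫⁻ ω, ∏ z ∈ T, (1 - (goodProb l (windowMass q b z (Λ ω)) : ℝ≥0∞)) ∂P := by
  classical
  -- Once the counts `m` are fixed, badness is an event of `Λ` alone, as `IsCoxProcess.poisson`
  -- requires. Summing over the countably many `m` under the integral rebuilds the conditional
  -- probability.
  let A : (T → Window d b → ℕ) → Set (Measure (Space d)) := fun m =>
    {μ | ∀ z : T, ¬ (GoodPattern {v | windowMass q b z μ v ≠ 0} ∧
      ∀ v, windowMass q b z μ v ≠ 0 → m z v ≠ 0)}
  have hA : ∀ m, MeasurableSet (A m) := by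
    intro m
    have hz : ∀ z : T, MeasurableSet {a : Window d b → ℝ≥0∞ | GoodPattern {v | a v ≠ 0} ∧
        ∀ v, a v ≠ 0 → m z v ≠ 0} := by
      intro z
      refine (measurableSet_goodPattern d b).inter ?_
      have : {a : Window d b → ℝ≥0∞ | ∀ v, a v ≠ 0 → m z v ≠ 0} =
          ⋂ v, {a | a v ≠ 0 → m z v ≠ 0} := by
        ext a
        simp
      refine MeasurableSet.congr ?_ this.symm
      refine MeasurableSet.iInter fun v => ?_
      by_cases hm : m z v = 0
      · have e : {a : Window d b → ℝ≥0∞ | a v ≠ 0 → m z v ≠ 0} = {a | a v = 0} := by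
          ext a
          simp [hm]
        rw [e]
        exact measurableSet_eq_fun (measurable_pi_apply v) measurable_const
      · simp [hm]
    have : A m = ⋂ z : T, (windowMass q b z : Measure (Space d) → _) ⁻¹'
        {a : Window d b → ℝ≥0∞ | GoodPattern {v | a v ≠ 0} ∧ ∀ v, a v ≠ 0 → m z v ≠ 0}ᶜ := by
      ext μ
      simp [A]
    rw [this]
    exact MeasurableSet.iInter fun z => measurable_windowMass q b z (hz z).compl
  let N : (T → Window d b → ℕ) → Set Ω := fun m =>
    {ω | ∀ (z : T) (v : Window d b), windowMass q b z (X ω) v = m z v}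
  let ν : Ω → Measure (T → Window d b → ℕ) := fun ω =>
    Measure.pi fun z : T => Measure.pi fun v =>
      poissonMeasure (l * (windowMass q b z (Λ ω) v).toNNReal)
  have hpois : ∀ m, P (Λ ⁻¹' A m ∩ N m) = ∫⁻ ω in Λ ⁻¹' A m, ν ω {m} ∂P := by
    intro m
    let e := (Fintype.equivFin (T × Window d b)).symm
    have h1 := hX.poisson _ (fun i => cell q (cellIndex b (e i).1 (e i).2.1))
      (fun i => measurableSet_cell _ _) (fun i => isBounded_cell hq _)
      (fun i j hij => disjoint_cell fun h => hij (by
        have h2 := hT _ (e i).1.2 _ (e j).1.2 _ _ h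
        exact e.injective (Prod.ext (Subtype.ext h2.1) h2.2)))
      (fun i => m (e i).1 (e i).2) (A m) (hA m)
    have h2 : {ω | ∀ i, X ω (cell q (cellIndex b (e i).1 (e i).2.1)) =
        ((m (e i).1 (e i).2 : ℕ) : ℝ≥0∞)} = N m := by
      ext ω
      constructor
      · intro h z v
        have := h (e.symm (z, v))
        simpa [windowMass] using this
      · intro h i
        exact h (e i).1 (e i).2
    rw [h2] at h1
    rw [h1]
    refine lintegral_congr fun ω => ?_
    simp only [ν, Measure.pi_singleton]
    rw [← Fintype.prod_prod_type' (f := fun (z : T) (v : Window d b) =>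
      poissonMeasure (l * (windowMass q b z (Λ ω) v).toNNReal) {m z v})]
    exact e.prod_comp (fun p : T × Window d b =>
      poissonMeasure (l * (windowMass q b p.1 (Λ ω) p.2).toNNReal) {m p.1 p.2})
  have hνmeas : ∀ m, Measurable fun ω => ν ω {m} := by
    intro m
    simp only [ν, Measure.pi_singleton, poissonMeasure_singleton]
    refine Finset.measurable_prod _ fun z _ => Finset.measurable_prod _ fun v _ => ?_
    have : Measurable fun ω => (l * (windowMass q b z (Λ ω) v).toNNReal : ℝ≥0) :=
      ((measurable_pi_apply v).comp
        ((measurable_windowMass q b z).comp hΛ)).ennreal_toNNReal.const_mul l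
    fun_prop
  have hcover : {ω | ∀ z ∈ T, ¬ GoodSite q b (Λ ω) (X ω) z} ≤ᵐ[P] ⋃ m, Λ ⁻¹' A m ∩ N m := by
    filter_upwards [hX.counting] with ω hω hbad
    have hk : ∀ (z : T) (v : Window d b), ∃ k : ℕ, windowMass q b z (X ω) v = k :=
      fun z v => hω _ (measurableSet_cell _ _) (isBounded_cell hq _)
    choose m hm using hk
    refine Set.mem_iUnion.2 ⟨m, fun z hz => hbad z z.2 ⟨hz.1, fun v hv => ?_⟩, hm⟩
    rw [hm]
    exact_mod_cast hz.2 v hv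
  calc P {ω | ∀ z ∈ T, ¬ GoodSite q b (Λ ω) (X ω) z} ≤ P (⋃ m, Λ ⁻¹' A m ∩ N m) :=
        measure_mono_ae hcover
    _ ≤ ∑' m, P (Λ ⁻¹' A m ∩ N m) := measure_iUnion_le _
    _ = ∑' m, ∫⁻ ω, (Λ ⁻¹' A m).indicator (fun ω => ν ω {m}) ω ∂P := by
        refine tsum_congr fun m => ?_
        rw [hpois, lintegral_indicator (hΛ (hA m))]
    _ = ∫⁻ ω, ∑' m, (Λ ⁻¹' A m).indicator (fun ω => ν ω {m}) ω ∂P := by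
        rw [lintegral_tsum]
        exact fun m => ((hνmeas m).indicator (hΛ (hA m))).aemeasurable
    _ = ∫⁻ ω, ∏ z ∈ T, (1 - (goodProb l (windowMass q b z (Λ ω)) : ℝ≥0∞)) ∂P := by
        refine lintegral_congr fun ω => ?_
        have h1 : ∀ m, (Λ ⁻¹' A m).indicator (fun ω => ν ω {m}) ω =
            {m | Λ ω ∈ A m}.indicator (fun m => ν ω {m}) m := fun m => rfl
        simp only [h1]
        rw [Measure.tsum_indicator_apply_singleton _ _ MeasurableSet.of_discrete]
        have h2 : {m | Λ ω ∈ A m} = Set.univ.pi fun z : T =>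
            {m : Window d b → ℕ | ¬ (GoodPattern {v | windowMass q b z (Λ ω) v ≠ 0} ∧
              ∀ v, windowMass q b z (Λ ω) v ≠ 0 → m v ≠ 0)} := by
          ext m
          simp [A]
        rw [h2, Measure.pi_pi]
        simp only [pi_poissonMeasure_not_good]
        exact Finset.prod_coe_sort T fun z => (1 - (goodProb l (windowMass q b z (Λ ω)) : ℝ≥0∞))

/-! ### Stationarity and stabilization -/

/-- The centre of the window of the site `z`. -/
def siteCenter (d k : ℕ) (z : ℤ × ℤ) : Space d :=
  WithLp.toLp 2 fun i => 3 * k * (planar d z i : ℝ)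

/-- The spacing `3 * k` amounts to `3 * q * k` cell sides, so the translation permutes the cells. -/
theorem shift_cell {d : ℕ} (q k : ℕ) (z : ℤ × ℤ) (μ : Measure (Space d)) (v : Fin d → ℤ) :
    shift (siteCenter d k z) μ (cell q v) = μ (cell q (cellIndex (q * k) z v)) := by
  rw [shift, Measure.map_apply (by fun_prop) (measurableSet_cell _ _)]
  congr 1
  ext y
  simp only [Set.mem_preimage, mem_cell_iff, cellIndex, siteCenter, PiLp.sub_apply]
  refine forall_congr' fun i => ?_
  push_cast
  constructor <;> rintro ⟨h1, h2⟩ <;> constructor <;> linarith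

theorem windowMass_shift {d : ℕ} (q k : ℕ) (z : ℤ × ℤ) (μ : Measure (Space d)) :
    windowMass q (q * k) 0 (shift (siteCenter d k z) μ) = windowMass q (q * k) z μ := by
  ext v
  simp only [windowMass, shift_cell]
  congr 2
  ext i
  simp [cellIndex, planar]

theorem siteCenter_mem_rationalPoints (d k : ℕ) (z : ℤ × ℤ) :
    siteCenter d k z ∈ rationalPoints d :=
  fun i => ⟨3 * k * planar d z i, by simp [siteCenter]⟩

theorem countable_rationalPoints (d : ℕ) : (rationalPoints d).Countable := by
  refine (Set.countable_range fun c : Fin d → ℚ =>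
    (WithLp.toLp 2 fun i => (c i : ℝ) : Space d)).mono ?_
  intro y hy
  choose c hc using hy
  refine ⟨c, ?_⟩
  ext i
  simp [hc]

/-- Translation by a rational vector preserves `ℚ^d`; this is why site centres must be rational. -/
theorem supRadius_eq_shift {d : ℕ} {Ω : Type*} (R : Space d → Ω → ℝ≥0∞) (s : ℝ) {x : Space d}
    (hx : x ∈ rationalPoints d) (ω : Ω) :
    supRadius R s x ω = ⨆ y ∈ cube s 0 ∩ rationalPoints d, R (y + x) ω := by
  refine le_antisymm (iSup₂_le fun y hy => ?_) (iSup₂_le fun y hy => ?_)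
  · have hmem : y - x ∈ cube s 0 ∩ rationalPoints d := by
      refine ⟨fun i => by simpa using hy.1 i, fun i => ?_⟩
      obtain ⟨a, ha⟩ := hy.2 i
      obtain ⟨c, hc⟩ := hx i
      exact ⟨a - c, by simp [ha, hc]⟩
    refine le_trans ?_ (le_iSup₂ (f := fun y _ => R (y + x) ω) (y - x) hmem)
    rw [sub_add_cancel]
  · have hmem : y + x ∈ cube s x ∩ rationalPoints d := by
      refine ⟨fun i => by simpa using hy.1 i, fun i => ?_⟩
      obtain ⟨a, ha⟩ := hy.2 i
      obtain ⟨c, hc⟩ := hx i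
      exact ⟨a + c, by simp [ha, hc]⟩
    exact le_iSup₂ (f := fun y _ => R y ω) (y + x) hmem

section Field

variable {d : ℕ} {Ω : Type*} [MeasurableSpace Ω] {P : Measure Ω} {Λ : Ω → Measure (Space d)}
  {R : Space d → Ω → ℝ≥0∞}

theorem IsStabilizationField.measurable_supRadius (hR : IsStabilizationField P Λ R) (s : ℝ)
    (x : Space d) : Measurable (supRadius R s x) := by
  unfold supRadius
  exact Measurable.biSup _ ((countable_rationalPoints d).mono Set.inter_subset_right)
    fun y _ => hR.measurable y

theorem IsStabilizationField.measure_supRadius (hR : IsStabilizationField P Λ R) (s : ℝ)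
    {x : Space d} (hx : x ∈ rationalPoints d) (t : ℝ≥0∞) :
    P {ω | ¬ supRadius R s x ω < t} = P {ω | ¬ supRadius R s 0 ω < t} := by
  have hmeas : Measurable fun p : Measure (Space d) × (Space d → ℝ≥0∞) =>
      ⨆ y ∈ cube s 0 ∩ rationalPoints d, p.2 y :=
    Measurable.biSup _ ((countable_rationalPoints d).mono Set.inter_subset_right)
      fun y _ => (measurable_pi_apply y).comp measurable_snd
  have h := ((hR.jointly_stationary x).comp hmeas).measure_mem_eq
    (measurableSet_Iio (a := t)).compl
  have e1 : {ω | ¬ supRadius R s x ω < t} = ((fun p : Measure (Space d) × (Space d → ℝ≥0∞) =>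
      ⨆ y ∈ cube s 0 ∩ rationalPoints d, p.2 y) ∘
      fun ω => (shift x (Λ ω), fun y : Space d => R (y + x) ω)) ⁻¹' (Set.Iio t)ᶜ := by
    ext ω
    simp [supRadius_eq_shift R s hx ω]
  rw [e1, h]
  rfl

/-- The masses of the cells in the window of the origin are almost surely finite. -/
theorem IsStationaryRandomMeasure.ae_windowMass_ne_top (hΛ : IsStationaryRandomMeasure P Λ)
    {q : ℕ} (hq : 0 < q) (b : ℕ) :
    ∀ᵐ ω ∂P, ∀ v : Window d b, windowMass q b 0 (Λ ω) v ≠ ∞ := by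
  refine ae_all_iff.2 fun v => ?_
  have hq' : (0 : ℝ) < q := by exact_mod_cast hq
  let U : Set (Space d) := {y | ∀ i, 0 ≤ y i ∧ y i ≤ 1}
  have hU : MeasurableSet U := by
    have : U = ⋂ i, ({y : Space d | 0 ≤ y i} ∩ {y | y i ≤ 1}) := by
      ext y
      simp [U]
    rw [this]
    exact MeasurableSet.iInter fun i =>
      (measurableSet_le measurable_const (by fun_prop)).inter
        (measurableSet_le (by fun_prop) measurable_const)
  -- The lower corner of the cell: as `1 / q ≤ 1`, the cell lies in a translated unit cube, of mean
  -- mass 1.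
  let x : Space d := WithLp.toLp 2 fun i => (cellIndex b 0 v.1 i : ℝ) / q
  have h1 : ∫⁻ ω, shift x (Λ ω) U ∂P = 1 := by
    rw [← hΛ.intensity]
    exact ((hΛ.stationary x).comp (Measure.measurable_coe hU)).lintegral_eq
  have hshift : ∀ μ : Measure (Space d), shift x μ U = μ ((fun y => y - x) ⁻¹' U) :=
    fun μ => Measure.map_apply (by fun_prop) hU
  simp only [hshift] at h1
  have hmeas : Measurable fun ω => Λ ω ((fun y => y - x) ⁻¹' U) :=
    (Measure.measurable_coe ((by fun_prop : Measurable fun y : Space d => y - x) hU)).comp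
      hΛ.measurable
  filter_upwards [ae_lt_top hmeas (by rw [h1]; exact ENNReal.one_ne_top)] with ω hω
  refine ne_top_of_le_ne_top hω.ne (measure_mono fun y hy i => ?_)
  have h2 := mem_cell_iff.1 hy i
  have hq1 : (1 : ℝ) ≤ q := by exact_mod_cast hq
  simp only [x, PiLp.sub_apply]
  constructor
  · rw [sub_nonneg, div_le_iff₀ hq']
    linarith
  · rw [sub_le_iff_le_add, ← sub_le_iff_le_add', le_div_iff₀ hq']
    nlinarith

variable [IsProbabilityMeasure P]

theorem IsStabilizationField.tendsto_zero (hR : IsStabilizationField P Λ R) :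
    Tendsto (fun n : ℕ => P {ω | ¬ supRadius R n 0 ω < (n : ℝ≥0∞)}) atTop (𝓝 0) := by
  have h : ∀ n : ℕ, P {ω | ¬ supRadius R n 0 ω < (n : ℝ≥0∞)} =
      1 - P {ω | supRadius R n 0 ω < (n : ℝ≥0∞)} := fun n =>
    prob_compl_eq_one_sub (s := {ω | supRadius R n 0 ω < (n : ℝ≥0∞)})
      (measurableSet_lt (hR.measurable_supRadius _ _) measurable_const)
  simp only [h]
  have h1 := ENNReal.Tendsto.sub (tendsto_const_nhds (x := (1 : ℝ≥0∞))) hR.tendsto_one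
    (Or.inl ENNReal.one_ne_top)
  simpa using h1

/-- The cube of side `4 * n` is covered by the cubes of side `n` centred at `n * c` with integer `|c
i| ≤ 2`; their number does not depend on `n`, so stationarity and a union bound suffice. -/
theorem IsStabilizationField.tendsto_zero_four (hR : IsStabilizationField P Λ R) :
    Tendsto (fun n : ℕ => P {ω | ¬ supRadius R (4 * n) 0 ω < (n : ℝ≥0∞)}) atTop (𝓝 0) := by
  classical
  let I : Finset (Fin d → ℤ) := Finset.Icc (fun _ => -2) (fun _ => 2)
  let x : ℕ → (Fin d → ℤ) → Space d := fun n c => WithLp.toLp 2 fun i => (n : ℝ) * c i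
  have hx : ∀ n c, x n c ∈ rationalPoints d := fun n c i => ⟨n * c i, by simp [x]⟩
  have hle : ∀ n : ℕ, P {ω | ¬ supRadius R (4 * n) 0 ω < (n : ℝ≥0∞)} ≤
      I.card * P {ω | ¬ supRadius R n 0 ω < (n : ℝ≥0∞)} := by
    intro n
    rcases Nat.eq_zero_or_pos n with rfl | hn
    · have : 1 ≤ I.card := Finset.card_pos.2 ⟨0, Finset.mem_Icc.2
        ⟨fun _ => by simp, fun _ => by simp⟩⟩
      simp only [Nat.cast_zero, mul_zero]
      exact le_mul_of_one_le_left' (by exact_mod_cast this)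
    have hn' : (0 : ℝ) < n := by exact_mod_cast hn
    have hcover : {ω | ¬ supRadius R (4 * n) 0 ω < (n : ℝ≥0∞)} ⊆
        ⋃ c ∈ I, {ω | ¬ supRadius R n (x n c) ω < (n : ℝ≥0∞)} := by
      intro ω hω
      by_contra hcon
      simp only [Set.mem_iUnion, Set.mem_ofPred_eq, not_exists, not_not] at hcon
      refine hω (lt_of_le_of_lt ?_ ((Finset.sup_lt_iff (f := fun c => supRadius R n (x n c) ω)
        (by simpa using hn)).2 hcon))
      refine iSup₂_le fun y hy => ?_
      let c : Fin d → ℤ := fun i => round (y i / n)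
      have hyi : ∀ i, |y i / n - round (y i / n)| ≤ 1 / 2 := fun i => abs_sub_round _
      have hcI : c ∈ I := by
        have hb : ∀ i, -2 ≤ c i ∧ c i ≤ 2 := by
          intro i
          have h1 : |y i - (0 : Space d) i| ≤ 4 * n / 2 := hy.1 i
          simp only [PiLp.zero_apply, sub_zero] at h1
          have h2 : |y i / n| ≤ 2 := by
            rw [abs_div, abs_of_pos hn', div_le_iff₀ hn']
            linarith
          rw [abs_le] at h2
          have h3 := abs_le.1 (hyi i)
          have h4 : (-3 : ℝ) < (c i : ℝ) := by simp only [c]; linarith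
          have h5 : (c i : ℝ) < 3 := by simp only [c]; linarith
          have h6 : -3 < c i := by exact_mod_cast h4
          have h7 : c i < 3 := by exact_mod_cast h5
          omega
        exact Finset.mem_Icc.2 ⟨fun i => (hb i).1, fun i => (hb i).2⟩
      refine le_trans ?_ (Finset.le_sup (f := fun c => supRadius R n (x n c) ω) hcI)
      refine le_iSup₂ (f := fun y _ => R y ω) y ⟨fun i => ?_, hy.2⟩
      have h1 := hyi i
      have h2 : y i - (x n c) i = n * (y i / n - round (y i / n)) := by
        simp only [x, c]
        field_simp
      rw [h2, abs_mul, abs_of_pos hn']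
      nlinarith
    calc P {ω | ¬ supRadius R (4 * n) 0 ω < (n : ℝ≥0∞)}
        ≤ P (⋃ c ∈ I, {ω | ¬ supRadius R n (x n c) ω < (n : ℝ≥0∞)}) := measure_mono hcover
      _ ≤ ∑ c ∈ I, P {ω | ¬ supRadius R n (x n c) ω < (n : ℝ≥0∞)} :=
          measure_biUnion_finset_le _ _
      _ = I.card * P {ω | ¬ supRadius R n 0 ω < (n : ℝ≥0∞)} := by
          rw [Finset.sum_congr rfl fun c _ => hR.measure_supRadius n (hx n c) n]
          simp
  have h1 := ENNReal.Tendsto.const_mul (a := (I.card : ℝ≥0∞)) hR.tendsto_zero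
    (Or.inr (ENNReal.natCast_ne_top _))
  rw [mul_zero] at h1
  exact tendsto_of_tendsto_of_tendsto_of_le_of_le tendsto_const_nhds h1 (fun _ => zero_le) hle

end Field

/-! ### Independence of distant sites -/

theorem exists_le_abs_planar_sub {d : ℕ} (hd : 2 ≤ d) {m : ℤ} {z z' : ℤ × ℤ}
    (h : m ≤ |z.1 - z'.1| ∨ m ≤ |z.2 - z'.2|) : ∃ i, m ≤ |planar d z i - planar d z' i| := by
  rcases h with h | h
  · exact ⟨⟨0, by omega⟩, by simpa [planar] using h⟩
  · exact ⟨⟨1, by omega⟩, by simpa [planar] using h⟩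

/-- Two windows have index radius `11 * b` each, while their centres are at least `75 * b` apart in
some coordinate. -/
theorem cellIndex_inj {d b : ℕ} (hb : 0 < b) {z z' : ℤ × ℤ}
    (h : z ≠ z' → ∃ i, 25 ≤ |planar d z i - planar d z' i|) {v v' : Window d b}
    (e : cellIndex b z v.1 = cellIndex b z' v'.1) : z = z' ∧ v = v' := by
  have hz : z = z' := by
    by_contra hne
    obtain ⟨i, hi⟩ := h hne
    have e1 := congrFun e i
    simp only [cellIndex] at e1
    have h1 := abs_le.1 (v.abs_le i)
    have h2 := abs_le.1 (v'.abs_le i)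
    have hb' : (0 : ℤ) < b := by exact_mod_cast hb
    rcases le_abs.1 hi with h3 | h3 <;> nlinarith
  subst hz
  refine ⟨rfl, Subtype.ext (funext fun i => ?_)⟩
  have e1 := congrFun e i
  simpa [cellIndex] using e1

theorem cell_subset_window {d q k : ℕ} (hq : 0 < q) (hk : 0 < k) (z : ℤ × ℤ)
    (v : Window d (q * k)) :
    cell q (cellIndex (q * k) z v.1) ⊆ cube (24 * k : ℕ) (siteCenter d k z) := by
  have hqk : (1 : ℝ) ≤ q * k := by exact_mod_cast Nat.mul_pos hq hk
  refine cell_subset_cube hq (m := 11 * (q * k)) (fun i => ?_) (by push_cast; nlinarith)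
  have h1 : |(v.1 i : ℝ)| ≤ 11 * (q * k) := by exact_mod_cast v.abs_le i
  convert h1 using 2
  simp only [cellIndex, siteCenter]
  push_cast
  ring

theorem windowMass_restrict_self {d q k : ℕ} (hq : 0 < q) (hk : 0 < k) (z : ℤ × ℤ)
    (μ : Measure (Space d)) :
    windowMass q (q * k) z (μ.restrict (cube (24 * k : ℕ) (siteCenter d k z))) =
      windowMass q (q * k) z μ := by
  ext v
  rw [windowMass, Measure.restrict_apply (measurableSet_cell _ _),
    Set.inter_eq_left.2 (cell_subset_window hq hk z v), windowMass]

theorem le_abs_siteCenter_sub {d k : ℕ} {z z' : ℤ × ℤ} {i : Fin d}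
    (h : 25 ≤ |planar d z i - planar d z' i|) :
    75 * (k : ℝ) ≤ |siteCenter d k z i - siteCenter d k z' i| := by
  have h1 : (25 : ℝ) ≤ |(planar d z i : ℝ) - planar d z' i| := by exact_mod_cast h
  simp only [siteCenter]
  rw [← mul_sub, abs_mul, abs_of_nonneg (by positivity : (0 : ℝ) ≤ 3 * k)]
  have hk : (0 : ℝ) ≤ k := by positivity
  nlinarith

theorem windowMass_restrict_of_ne {d q k : ℕ} (hq : 0 < q) (hk : 0 < k) {z z' : ℤ × ℤ}
    (h : ∃ i, 25 ≤ |planar d z i - planar d z' i|) (μ : Measure (Space d)) :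
    windowMass q (q * k) z' (μ.restrict (cube (24 * k : ℕ) (siteCenter d k z))) = 0 := by
  ext v
  have hdisj : cell q (cellIndex (q * k) z' v.1) ∩ cube (24 * k : ℕ) (siteCenter d k z) = ∅ := by
    refine Set.eq_empty_of_forall_notMem fun y hy => ?_
    obtain ⟨i, hi⟩ := h
    have h1 := le_abs_siteCenter_sub (k := k) hi
    have h2 := hy.2 i
    have h3 := cell_subset_window hq hk z' v hy.1 i
    have hk' : (0 : ℝ) < k := by exact_mod_cast hk
    push_cast at h2 h3
    rw [abs_le] at h2 h3
    rcases le_abs.1 h1 with h4 | h4 <;> linarith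
  rw [windowMass, Measure.restrict_apply (measurableSet_cell _ _), hdisj]
  simp

/-- The separation 25 is chosen for this: `25 * 3 * k = 75 * k` exceeds `3 * (24 * k)`. -/
theorem lt_dist_siteCenter {d k : ℕ} (hk : 0 < k) {z z' : ℤ × ℤ}
    (h : ∃ i, 25 ≤ |planar d z i - planar d z' i|) :
    3 * ((24 * k : ℕ) : ℝ) < dist (siteCenter d k z) (siteCenter d k z') := by
  obtain ⟨i, hi⟩ := h
  have h1 := le_abs_siteCenter_sub (k := k) hi
  have h2 := PiLp.norm_apply_le (siteCenter d k z - siteCenter d k z') i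
  rw [← dist_eq_norm, Real.norm_eq_abs, PiLp.sub_apply] at h2
  have hk' : (0 : ℝ) < k := by exact_mod_cast hk
  push_cast
  linarith

section Field

variable {d : ℕ} {Ω : Type*} [MeasurableSpace Ω] {P : Measure Ω} {Λ : Ω → Measure (Space d)}
  {R : Space d → Ω → ℝ≥0∞}

/-- Truncating `goodProb` to zero where the radii are large only increases the integrand and makes
the factors independent. Each factor then pays at most the probability of large radii. -/
theorem IsStabilizationField.lintegral_prod_le (hR : IsStabilizationField P Λ R)
    (hΛ : Measurable Λ) {q k : ℕ} (hq : 0 < q) (hk : 0 < k) (l : ℝ≥0) (T : Finset (ℤ × ℤ))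
    (hT : ∀ z ∈ T, ∀ z' ∈ T, z ≠ z' → ∃ i, 25 ≤ |planar d z i - planar d z' i|) :
    ∫⁻ ω, ∏ z ∈ T, (1 - (goodProb l (windowMass q (q * k) z (Λ ω)) : ℝ≥0∞)) ∂P ≤
      ∏ z ∈ T, (P {ω | ¬ supRadius R (24 * k : ℕ) (siteCenter d k z) ω < ((24 * k : ℕ) : ℝ≥0∞)} +
        ∫⁻ ω, (1 - (goodProb l (windowMass q (q * k) z (Λ ω)) : ℝ≥0∞)) ∂P) := by
  classical
  set n := 24 * k with hn
  set c := siteCenter d k with hc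
  -- Stabilization allows only one function for all centres. Restricting to the cube around a site
  -- kills every summand but its own.
  let f : Measure (Space d) → ℝ≥0 := fun μ => ∑ z ∈ T, goodProb l (windowMass q (q * k) z μ)
  have hf : Measurable f := Finset.measurable_sum _ fun z _ =>
    (measurable_goodProb l).comp (measurable_windowMass q (q * k) z)
  have hfb : ∃ C : ℝ≥0, ∀ μ, f μ ≤ C :=
    ⟨∑ z ∈ T, 1, fun μ => Finset.sum_le_sum fun z _ => goodProb_le_one _ _⟩
  have hfz : ∀ z ∈ T, ∀ μ, f (μ.restrict (cube n (c z))) =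
      goodProb l (windowMass q (q * k) z μ) := by
    intro z hz μ
    simp only [f]
    rw [Finset.sum_eq_single z, windowMass_restrict_self hq hk]
    · intro z' hz' hne
      rw [windowMass_restrict_of_ne hq hk (hT z hz z' hz' hne.symm), goodProb_zero]
    · exact fun h => absurd hz h
  have hcinj : Set.InjOn c T := by
    intro z hz z' hz' e
    by_contra hne
    have h1 := lt_dist_siteCenter hk (hT z hz z' hz' hne)
    rw [← hc, e, dist_self] at h1
    have : (0 : ℝ) ≤ ((24 * k : ℕ) : ℝ) := by positivity
    linarith
  let φ : Finset (Space d) := T.image c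
  have hφ : ∀ x ∈ φ, ∀ y ∈ φ, y ≠ x → 3 * (n : ℝ) < dist x y := by
    intro x hx y hy hne
    obtain ⟨z, hz, rfl⟩ := Finset.mem_image.1 hx
    obtain ⟨z', hz', rfl⟩ := Finset.mem_image.1 hy
    exact lt_dist_siteCenter hk (hT z hz z' hz' fun e => hne (by rw [e]))
  let Y : Space d → Ω → ℝ≥0 := fun x =>
    Set.indicator {ω | supRadius R n x ω < (n : ℝ≥0∞)} fun ω => f ((Λ ω).restrict (cube n x))
  have hYmeas : ∀ x, Measurable (Y x) := by
    intro x
    refine Measurable.indicator ?_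
      (measurableSet_lt (hR.measurable_supRadius _ _) measurable_const)
    refine hf.comp (Measure.measurable_of_measurable_coe _ fun B hB => ?_)
    simp only [Measure.restrict_apply hB]
    exact (Measure.measurable_coe (hB.inter (measurableSet_cube _ _))).comp hΛ
  have hind : iIndepFun (fun (x : φ) => Y x) P := hR.indep n (by omega) f hf hfb φ hφ
  let g : ℝ≥0 → ℝ≥0∞ := fun t => 1 - (t : ℝ≥0∞)
  have hg : Measurable g := measurable_coe_nnreal_ennreal.const_sub 1
  have hprod := lintegral_prod_eq_prod_lintegral_of_indepFun Finset.univ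
    (fun (x : φ) => g ∘ Y x) (hind.comp (fun _ => g) fun _ => hg)
    (fun x => hg.comp (hYmeas x))
  have hYle : ∀ z ∈ T, ∀ ω, Y (c z) ω ≤ goodProb l (windowMass q (q * k) z (Λ ω)) := by
    intro z hz ω
    simp only [Y]
    refine (Set.indicator_le_self' (fun _ _ => zero_le) ω).trans_eq (hfz z hz _)
  have e1 : ∀ ω, ∏ x : φ, (g ∘ Y x) ω = ∏ z ∈ T, g (Y (c z) ω) := by
    intro ω
    rw [Finset.prod_coe_sort φ fun x => (g ∘ Y x) ω, Finset.prod_image hcinj]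
    rfl
  have e2 : ∏ x : φ, ∫⁻ ω, (g ∘ Y x) ω ∂P = ∏ z ∈ T, ∫⁻ ω, g (Y (c z) ω) ∂P := by
    rw [Finset.prod_coe_sort φ fun x => ∫⁻ ω, (g ∘ Y x) ω ∂P, Finset.prod_image hcinj]
    rfl
  simp only [e1, e2] at hprod
  calc ∫⁻ ω, ∏ z ∈ T, (1 - (goodProb l (windowMass q (q * k) z (Λ ω)) : ℝ≥0∞)) ∂P
      ≤ ∫⁻ ω, ∏ z ∈ T, g (Y (c z) ω) ∂P := by
        refine lintegral_mono fun ω => Finset.prod_le_prod' fun z hz => ?_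
        exact tsub_le_tsub_left (ENNReal.coe_le_coe.2 (hYle z hz ω)) 1
    _ = ∏ z ∈ T, ∫⁻ ω, g (Y (c z) ω) ∂P := hprod
    _ ≤ _ := by
        refine Finset.prod_le_prod' fun z hz => ?_
        have hms : MeasurableSet {ω | ¬ supRadius R n (c z) ω < (n : ℝ≥0∞)} :=
          (measurableSet_lt (hR.measurable_supRadius _ _) measurable_const).compl
        rw [← lintegral_indicator_one hms, ← lintegral_add_left (measurable_one.indicator hms)]
        refine lintegral_mono fun ω => ?_
        by_cases hω : supRadius R n (c z) ω < (n : ℝ≥0∞)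
        · have hY : Y (c z) ω = goodProb l (windowMass q (q * k) z (Λ ω)) := by
            simp only [Y]
            rw [Set.indicator_of_mem (by exact hω), hfz z hz]
          rw [hY]
          exact le_add_self
        · rw [Set.indicator_of_mem (by exact hω)]
          exact tsub_le_self.trans le_self_add

/-- If the window of the origin is good with high probability for a dense process, then so are
all sites, with a product bound for distant ones. -/
theorem measure_forall_not_goodSite_le_pow (hd : 2 ≤ d) (hΛ : IsStationaryRandomMeasure P Λ)
    (hR : IsStabilizationField P Λ R) {q k : ℕ} (hq : 0 < q) (hk : 0 < k) {l : ℝ≥0}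
    {X : Ω → Measure (Space d)} (hX : IsCoxProcess P Λ l X) {ε : ℝ≥0∞}
    (hε : P {ω | ¬ supRadius R (24 * k : ℕ) 0 ω < ((24 * k : ℕ) : ℝ≥0∞)} +
      ∫⁻ ω, (1 - (goodProb l (windowMass q (q * k) 0 (Λ ω)) : ℝ≥0∞)) ∂P ≤ ε)
    (T : Finset (ℤ × ℤ)) (hT : ∀ u ∈ T, ∀ v ∈ T, u ≠ v →
      ((25 : ℕ) : ℤ) ≤ |u.1 - v.1| ∨ ((25 : ℕ) : ℤ) ≤ |u.2 - v.2|) :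
    P {ω | ∀ z ∈ T, ¬ GoodSite q (q * k) (Λ ω) (X ω) z} ≤ ε ^ T.card := by
  have hT' : ∀ z ∈ T, ∀ z' ∈ T, z ≠ z' → ∃ i, 25 ≤ |planar d z i - planar d z' i| :=
    fun z hz z' hz' hne => exists_le_abs_planar_sub hd (hT z hz z' hz' hne)
  refine (hX.measure_forall_not_goodSite_le hΛ.measurable hq T fun z hz z' hz' v v' e =>
    cellIndex_inj (Nat.mul_pos hq hk) (hT' z hz z' hz') e).trans ?_
  refine (hR.lintegral_prod_le hΛ.measurable hq hk l T hT').trans ?_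
  rw [← Finset.prod_const]
  refine Finset.prod_le_prod' fun z _ => le_trans (le_of_eq ?_) hε
  congr 1
  · exact hR.measure_supRadius _ (siteCenter_mem_rationalPoints d k z) _
  · have hmeas : Measurable fun μ : Measure (Space d) =>
        (1 - (goodProb l (windowMass q (q * k) 0 μ) : ℝ≥0∞)) :=
      (((measurable_goodProb l).comp
        (measurable_windowMass q (q * k) 0)).coe_nnreal_ennreal).const_sub 1
    have h := ((hΛ.stationary (siteCenter d k z)).comp hmeas).lintegral_eq
    simpa only [Function.comp_def, windowMass_shift] using h

/-- By dominated convergence: at high intensity every charged cell is hit, and only the geometry of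
`Λ` can fail. -/
theorem tendsto_lintegral_goodProb [IsProbabilityMeasure P]
    (hΛ : IsStationaryRandomMeasure P Λ) {q : ℕ} (hq : 0 < q) (b : ℕ) :
    Tendsto (fun l : ℕ => ∫⁻ ω, (1 - (goodProb l (windowMass q b 0 (Λ ω)) : ℝ≥0∞)) ∂P) atTop
      (𝓝 (P {ω | ¬ GoodPattern {v | windowMass q b 0 (Λ ω) v ≠ 0}})) := by
  have hm : Measurable fun ω => windowMass q b 0 (Λ ω) :=
    (measurable_windowMass q b 0).comp hΛ.measurable
  have hms : MeasurableSet {ω | ¬ GoodPattern {v | windowMass q b 0 (Λ ω) v ≠ 0}} :=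
    (hm (measurableSet_goodPattern d b)).compl
  rw [← lintegral_indicator_one hms]
  refine tendsto_lintegral_of_dominated_convergence (fun _ => 1)
    (fun l => (((measurable_goodProb l).comp hm).coe_nnreal_ennreal).const_sub 1)
    (fun l => ae_of_all _ fun ω => tsub_le_self) (by simp) ?_
  filter_upwards [hΛ.ae_windowMass_ne_top hq b] with ω hω
  by_cases hgood : GoodPattern {v | windowMass q b 0 (Λ ω) v ≠ 0}
  · rw [Set.indicator_of_notMem (by simpa using hgood)]
    have h1 : Tendsto (fun l : ℕ => goodProb l (windowMass q b 0 (Λ ω))) atTop (𝓝 1) := by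
      simp only [goodProb, if_pos hgood]
      have := tendsto_finsetProd (Finset.univ : Finset (Window d b))
        fun v _ => tendsto_hitProb (hω v)
      simpa using this
    have h2 := ENNReal.Tendsto.sub (tendsto_const_nhds (x := (1 : ℝ≥0∞)))
      (ENNReal.tendsto_coe.2 h1) (Or.inl ENNReal.one_ne_top)
    simpa using h2
  · rw [Set.indicator_of_mem (by exact hgood)]
    simp [goodProb, if_neg hgood]

end Field

end CoxPercolation

end

/-! ### Choice of the scales and of the intensity -/

open CoxPercolation in
theorem theorem2p2 {d : ℕ} (hd : 2 ≤ d) {Ω : Type*} [MeasurableSpace Ω]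
    (P : Measure Ω) [IsProbabilityMeasure P]
    (Λ : Ω → Measure (CoxPercolation.Space d))
    (hΛ : CoxPercolation.IsStationaryRandomMeasure P Λ)
    (hconn : CoxPercolation.IsAsymptoticallyEssentiallyConnected P Λ)
    (X : ℝ≥0 → Ω → Measure (CoxPercolation.Space d))
    (hX : ∀ l : ℝ≥0, 0 < l → CoxPercolation.IsCoxProcess P Λ l (X l))
    (r : ℝ) (hr : 0 < r) :
    CoxPercolation.criticalIntensity P X r < ∞ := by
  obtain ⟨R, hR, hAEC⟩ := hconn
  obtain ⟨q, hqr⟩ := exists_nat_gt (4 * d / r)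
  have hqr' : 4 * (d : ℝ) < r * q := by
    rw [div_lt_iff₀ hr] at hqr
    linarith
  have hq : 0 < q := by
    have : (0 : ℝ) < q := lt_of_le_of_lt (by positivity) hqr
    exact_mod_cast this
  -- The Peierls threshold for separation `N = 25`.
  set ε : ℝ≥0∞ := (1 / 18 : ℝ≥0∞) ^ (25 ^ 2) with hε
  have hε0 : ε ≠ 0 := pow_ne_zero _ (by simp)
  have hδ : 0 < ε / 4 := ENNReal.div_pos hε0 (by simp)
  have hmul : ∀ m : ℕ, 0 < m → Tendsto (fun u : ℕ => m * u) atTop atTop :=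
    fun m hm => tendsto_id.const_mul_atTop' hm
  -- With `k = 2 * u`, the three bounds serve connectedness at scale `k`, connectedness at scale `10
  -- * k`, and independence at scale `24 * k = 48 * u`. The factor 2 makes the thresholds `k / 2`
  -- and `10 * k / 2` integers.
  obtain ⟨u, hu1, hu2, hu3, hu4⟩ := ((eventually_ge_atTop 1).and
    ((hR.tendsto_zero_four.eventually_le_const hδ).and
    (((hR.tendsto_zero_four.comp (hmul 10 (by norm_num))).eventually_le_const hδ).and
    ((hR.tendsto_zero.comp (hmul 48 (by norm_num))).eventually_le_const hδ)))).exists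
  simp only [Function.comp_apply] at hu3 hu4
  set k := 2 * u with hk
  have hkpos : 0 < k := by omega
  have hpattern : P {ω | ¬ GoodPattern {v | windowMass q (q * k) 0 (Λ ω) v ≠ 0}} ≤
      ε / 4 + ε / 4 := by
    have hhalf : ∀ m : ℕ, ((2 * m : ℕ) : ℝ≥0∞) / 2 = m := by
      intro m
      push_cast
      rw [mul_comm, ENNReal.mul_div_cancel_right (by simp) (by simp)]
    calc P {ω | ¬ GoodPattern {v | windowMass q (q * k) 0 (Λ ω) v ≠ 0}}
        ≤ P ({ω | ¬ supRadius R (4 * u) 0 ω < (u : ℝ≥0∞)} ∪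
          {ω | ¬ supRadius R (4 * (10 * u : ℕ)) 0 ω < ((10 * u : ℕ) : ℝ≥0∞)}) := by
          refine measure_mono_ae ?_
          filter_upwards [hAEC] with ω hω hbad
          by_contra hcon
          obtain ⟨hcon1, hcon2⟩ := not_or.1 hcon
          replace hcon1 : supRadius R (4 * u) 0 ω < (u : ℝ≥0∞) := not_not.1 hcon1
          replace hcon2 : supRadius R (4 * (10 * u : ℕ)) 0 ω < ((10 * u : ℕ) : ℝ≥0∞) :=
            not_not.1 hcon2
          have h1 := hω k (by omega) (by
            rw [hk, hhalf]
            convert hcon1 using 2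
            push_cast
            ring)
          have h2 := hω (10 * k) (by omega) (by
            rw [hk, show 10 * (2 * u) = 2 * (10 * u) by ring, hhalf]
            convert hcon2 using 2
            push_cast
            ring)
          refine hbad (goodPattern_of_support hq (by omega) (Λ ω) h1.1 ?_)
          have e1 : (((10 * k : ℕ) : ℝ)) = 10 * k := by push_cast; ring
          have e2 : 2 * (((10 * k : ℕ) : ℝ)) = 20 * k := by push_cast; ring
          have h3 := h2.2
          rw [e2, e1] at h3
          exact h3
      _ ≤ _ := (measure_union_le _ _).trans (add_le_add hu2 hu3)
  have hlt : P {ω | ¬ GoodPattern {v | windowMass q (q * k) 0 (Λ ω) v ≠ 0}} <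
      ε / 4 + ε / 4 + ε / 4 := by
    refine lt_of_le_of_lt hpattern (ENNReal.lt_add_right ?_ hδ.ne')
    have : ε ≠ ∞ := ENNReal.pow_ne_top (by simp)
    exact ENNReal.add_ne_top.2 ⟨ENNReal.div_ne_top this (by simp),
      ENNReal.div_ne_top this (by simp)⟩
  -- The intensity is chosen last, for fixed `q` and `k`; unfilled cells cost at most one more
  -- quarter of `ε`.
  obtain ⟨l, hl1, hl⟩ := ((eventually_ge_atTop 1).and
    ((tendsto_lintegral_goodProb hΛ hq (q * k)).eventually_lt_const hlt)).exists
  have hlpos : (0 : ℝ≥0) < l := by exact_mod_cast hl1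
  have hsum : P {ω | ¬ supRadius R (24 * k : ℕ) 0 ω < ((24 * k : ℕ) : ℝ≥0∞)} +
      ∫⁻ ω, (1 - (goodProb l (windowMass q (q * k) 0 (Λ ω)) : ℝ≥0∞)) ∂P ≤ ε := by
    rw [hk, show 24 * (2 * u) = 48 * u by ring]
    refine (add_le_add hu4 hl.le).trans_eq ?_
    have : ε / 4 + (ε / 4 + ε / 4 + ε / 4) = 4 * (ε / 4) := by ring
    rw [this, ENNReal.mul_div_cancel (by simp) (by simp)]
  have hperc : ¬ ∀ᵐ ω ∂P,
      (originCluster {z | GoodSite q (q * k) (Λ ω) (X l ω) z}).Finite := by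
    have h := not_ae_finite_originCluster (P := P)
      (fun z => {ω | ¬ GoodSite q (q * k) (Λ ω) (X l ω) z}) (N := 25) (by norm_num)
      fun T hT => measure_forall_not_goodSite_le_pow hd hΛ hR hq hkpos (hX l hlpos) hsum T hT
    simpa using h
  have hpos : 0 < P {ω | Percolates r (X l ω)} := by
    rw [pos_iff_ne_zero]
    intro h0
    refine hperc ?_
    filter_upwards [(hX l hlpos).counting, measure_eq_zero_iff_ae_notMem.1 h0] with ω hω hnot
    by_contra hinf
    exact hnot (percolates_of_infinite_originCluster hd hq (Nat.mul_pos hq hkpos) hr hqr' hω hinf)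
  exact (iInf₂_le (l : ℝ≥0) ⟨hlpos, hpos⟩).trans_lt ENNReal.coe_lt_top
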